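/- Let $\Lambda\in\mathbb R$ (Lorentzian signature) and let $R_\Lambda$ be the commutative ring $\mathbb R^2$ with $(a,b)(c,d)=(ac+\Lambda bd,\,ad+bc)$; write $(a,b)=a+\Theta_\Lambda b$, so that $\Theta_\Lambda^2=\Lambda$. Let $(\eta_{ab})=\mathrm{diag}(-1,1,1)$ and let $\mathfrak h_\Lambda$ be the real Lie algebra with basis $J_a,P_a$ ($a=0,1,2$) and $[J_a,J_b]=\epsilon_{ab}{}^cJ_c$, $[J_a,P_b]=\epsilon_{ab}{}^cP_c$, $[P_a,P_b]=\Lambda\epsilon_{ab}{}^cJ_c$ (indices raised with $\eta_{ab}$, $\epsilon_{012}=1$). It carries the symmetric bilinear forms with $\langle J_a,P_b\rangle=\eta_{ab}$, $\langle J_a,J_b\rangle=\langle P_a,P_b\rangle=0$ and $\kappa(J_a,J_b)=\eta_{ab}$, $\kappa(J_a,P_b)=0$, $\kappa(P_a,P_b)=\Lambda\eta_{ab}$. For a bilinear form $\beta$ let $l_\beta$ be the linear map with $\langle l_\beta x,y\rangle=\beta(x,y)$; put $l_t=l_{\langle\,,\,\rangle}$. Represent $J_a$ by the matrices $J_0=\frac12\begin{pmatrix}0&-1\\1&0\end{pmatrix}$,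 $J_1=\frac12\begin{pmatrix}1&0\\0&-1\end{pmatrix}$, $J_2=\frac12\begin{pmatrix}0&1\\1&0\end{pmatrix}$, let $g_K(X,Y)=\mathrm{Tr}(XY)$ on $\mathfrak{sl}(2,R_\Lambda)$ (the $R_\Lambda$-bilinear extension of $g_K(J_a,J_b)=\frac12\eta_{ab}$), and let $\exp_\Lambda(X)=\sum_n X^n/n!$, with values in the gauge group $I_\Lambda=PSL(2,R_\Lambda)$. (1) *Algebra.* $p^aJ_a+k^aP_a\mapsto(p^a+\Theta_\Lambda k^a)J_a$ is a real Lie algebra isomorphism $\mathfrak h_\Lambda\to\mathfrak{sl}(2,R_\Lambda)$ (so $P_a=\Theta_\Lambda J_a$). Under it $g_K=\frac12\kappa+\frac12\Theta_\Lambda\langle\,,\,\rangle$, $l_t=\mathrm{id}$, $l_\kappa(J_a)=P_a$, $l_\kappa(P_a)=\Lambda J_a$, and $l_\kappa(X)=\Theta_\Lambda X$ for all $X\in\mathfrak{sl}(2,R_\Lambda)$. (2) *Gauge group.* There is a group isomorphism $\Phi$ from $I_\Lambda$ to $PSL(2,\mathbb R)\ltimes\mathfrak{sl}(2,\mathbb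 R)$ (adjoint action) if $\Lambda=0$, to $PSL(2,\mathbb R)\times PSL(2,\mathbb R)$ if $\Lambda>0$, to $PSL(2,\mathbb C)$ if $\Lambda<0$, which takes $\exp_\Lambda(p^aJ_a+k^aP_a)$ to, respectively, $(e^{p^aJ_a},T(p)k)$ with $T(p)k=\sum_n \mathrm{ad}_{p^aJ_a}^n(k^aJ_a)/(n+1)!$; $(e^{(p^a+\sqrt\Lambda k^a)J_a},e^{(p^a-\sqrt\Lambda k^a)J_a})$; $e^{(p^a+i\sqrt{|\Lambda|}k^a)J_a}$. The exponential map is not injective, so let $\log$ be any local right inverse of $\exp_\Lambda$ on a set $U\subset I_\Lambda$ that is open along the left-invariant vector fields of $I_\Lambda$, differentiable along them at the points of $U$ (for example a smooth local inverse on an open set). Put $\tilde\kappa(u)=\frac12\kappa(\log u,\log u)$, $\tilde t(u)=\frac12\langle\log u,\log u\rangle$, $\widetilde{g_K}(u)=\frac12g_K(\log u,\log u)\in R_\Lambda$. For $f\in\{\tilde\kappa,\tilde t\}$ let $g_f(u)\in\mathfrak h_\Lambda$ be determined by $\langle g_f(u),Y\rangle=\frac{d}{ds}\big|_{s=0}f(u\,e^{sY})$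 for $Y\in\{J_a,P_a\}$, and for $s\in R_\Lambda$ put $G^s_f(u)=\exp_\Lambda(s\,g_f(u))$ and $u^s=\exp_\Lambda(s\log u)$. (3) *The functions $G$.* For $u\in U$, $t\in\mathbb R$, $s\in R_\Lambda$: $\langle g_f(u),Y\rangle$ is the derivative of $f$ at $u$ along every $Y\in\mathfrak h_\Lambda$; $g_{\tilde t}(u)=\log u$, $g_{\tilde\kappa}(u)=l_\kappa(\log u)$; $G^s_{\tilde t}(u)=u^s$; $G^t_{\tilde\kappa}(u)=\exp_\Lambda(t\Theta_\Lambda\log u)$; hence $G^t_{\tilde\kappa}=G^{t\Theta_\Lambda}_{\tilde t}$ on $U$. If $\log u=p^aJ_a+k^aP_a$, then $\Phi(G^t_{\tilde\kappa}(u))$ is $(1,t\,p^aJ_a)$, $(e^{t\sqrt\Lambda(p^a+\sqrt\Lambda k^a)J_a},e^{-t\sqrt\Lambda(p^a-\sqrt\Lambda k^a)J_a})$, $e^{it\sqrt{|\Lambda|}(p^a+i\sqrt{|\Lambda|}k^a)J_a}$ for $\Lambda=0$, $\Lambda>0$, $\Lambda<0$. (4) *Grafting as deformed Dehn twist.* Consider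 the holonomies $(A_1,B_1,\dots,A_g,B_g)\in I_\Lambda^{2g}$ along generators $a_i,b_i$ of the fundamental group of a closed surface of genus $g$. Write $H_i=B_iA_i^{-1}B_i^{-1}A_i$; the dual generators $\mathring a_i,\mathring b_i$ have holonomies $H_1^{-1}\cdots H_i^{-1}B_iH_{i-1}\cdots H_1$ and $H_1^{-1}\cdots H_i^{-1}A_iH_{i-1}\cdots H_1$. Let $\eta=x_r^{\alpha_r}\circ\dots\circ x_1^{\alpha_1}$, $\alpha_k=\pm1$, be a word in the dual generators with holonomy $H_\eta$, for example the word of a closed simple curve; let $\eta_k=x_{k-1}^{\alpha_{k-1}}\cdots x_1^{\alpha_1}x_r^{\alpha_r}\cdots x_k^{\alpha_k}$ if $\alpha_k=1$ and $\eta_k=x_k^{\alpha_k}\cdots x_1^{\alpha_1}x_r^{\alpha_r}\cdots x_{k+1}^{\alpha_{k+1}}$ if $\alpha_k=-1$. For $s\in R_\Lambda$ let $T^s_{f,\eta}$ be the transformation $$A_i\mapsto A_i\,(H_{i-1}\cdots H_1)\prod_{x_k=\mathring a_i}G_f^{-s\alpha_k}(H_{\eta_k})\,(H_{i-1}\cdots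 H_1)^{-1},$$ $$B_i\mapsto B_i\,(B_i^{-1}A_iH_{i-1}\cdots H_1)\prod_{x_k=\mathring b_i}G_f^{-s\alpha_k}(H_{\eta_k})\,(B_i^{-1}A_iH_{i-1}\cdots H_1)^{-1},$$ the factors being ordered from the right to the left in the order in which the intersection points $k$ occur on the generator (any fixed order is allowed). Here $T^t_{\tilde\kappa,\eta}$, $t\in\mathbb R$, is grafting along $\eta$, and $T^s_{\tilde t,\eta}$ is the Dehn twist flow along $\eta$ with parameter $s$. If all $H_{\eta_k}$ lie in $U$, then for all $t\in\mathbb R$ $$T^t_{\tilde\kappa,\eta}(A_1,\dots,B_g)=T^{t\Theta_\Lambda}_{\tilde t,\eta}(A_1,\dots,B_g).$$ (5) *Observables.* With $f_\eta(A_1,\dots,B_g)=f(H_\eta)$, the $R_\Lambda$-valued Wilson loop satisfies $\widetilde{g_K}_\eta=\frac12\tilde\kappa_\eta+\frac12\Theta_\Lambda\,\tilde t_\eta$. -/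

import Mathlib

open scoped Topology Nat MatrixGroups
open Matrix

noncomputable section

namespace Grafting

/-! ### The ring `R_Λ` and its topology -/

/-- The commutative ring `R_Λ`: pairs `(a, b) = a + Θ b` of reals with
`(a, b) * (c, d) = (a c + Λ b d, a d + b c)`. -/
abbrev RL (Λ : ℝ) : Type := QuadraticAlgebra ℝ Λ 0

/-- The element `Θ_Λ = (0, 1)`, which satisfies `Θ * Θ = Λ`. -/
def Θ (Λ : ℝ) : RL Λ := ⟨0, 1⟩

/-- `R_Λ` carries the topology of `ℝ²`, here given by the submultiplicative norm
`|a| + (1 + |Λ|) |b|`. -/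
instance instNormedAddCommGroupRL (Λ : ℝ) : NormedAddCommGroup (RL Λ) :=
  AddGroupNorm.toNormedAddCommGroup
    { toFun := fun z => |z.re| + (1 + |Λ|) * |z.im|
      map_zero' := by simp
      add_le' := fun x y => by
        have h1 := abs_add_le x.re y.re
        have h2 := abs_add_le x.im y.im
        have h3 : (0 : ℝ) ≤ 1 + |Λ| := by positivity
        simp only [QuadraticAlgebra.re_add, QuadraticAlgebra.im_add]
        nlinarith
      neg' := fun x => by simp
      eq_zero_of_map_eq_zero' := fun x hx => by
        have h3 : (0 : ℝ) < 1 + |Λ| := by positivity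
        have h1 := abs_nonneg x.re
        have h2 : 0 ≤ (1 + |Λ|) * |x.im| := by positivity
        have h4 : |x.re| = 0 := by linarith
        have h5 : (1 + |Λ|) * |x.im| = 0 := by linarith
        have h6 : |x.im| = 0 := by
          rcases mul_eq_zero.mp h5 with h | h
          · exact absurd h h3.ne'
          · exact h
        ext
        · simpa using h4
        · simpa using h6 }

theorem norm_def_RL {Λ : ℝ} (z : RL Λ) : ‖z‖ = |z.re| + (1 + |Λ|) * |z.im| := rfl

instance instNormedCommRingRL (Λ : ℝ) : NormedCommRing (RL Λ) where
  __ := instNormedAddCommGroupRL Λ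
  __ := (inferInstance : CommRing (RL Λ))
  norm_mul_le x y := by
    change |(x * y).re| + (1 + |Λ|) * |(x * y).im| ≤
      (|x.re| + (1 + |Λ|) * |x.im|) * (|y.re| + (1 + |Λ|) * |y.im|)
    simp only [QuadraticAlgebra.re_mul, QuadraticAlgebra.im_mul, zero_mul, add_zero]
    have h1 := abs_add_le (x.re * y.re) (Λ * x.im * y.im)
    have h2 := abs_add_le (x.re * y.im) (x.im * y.re)
    simp only [abs_mul] at h1 h2
    have h3 : (0 : ℝ) ≤ |Λ| := abs_nonneg _
    have h4 : 0 ≤ |x.im| * |y.im| := by positivity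
    have h5 := mul_nonneg h3 h4
    have h6 := mul_nonneg h3 h5
    nlinarith

instance instNormedAlgebraRL (Λ : ℝ) : NormedAlgebra ℝ (RL Λ) where
  __ := (inferInstance : Algebra ℝ (RL Λ))
  norm_smul_le r x := by
    simp only [norm_def_RL, QuadraticAlgebra.re_smul, QuadraticAlgebra.im_smul, smul_eq_mul,
      abs_mul, Real.norm_eq_abs]
    apply le_of_eq
    ring

instance instCompleteSpaceRL (Λ : ℝ) : CompleteSpace (RL Λ) :=
  FiniteDimensional.complete ℝ (RL Λ)

/-! ### Matrices over a commutative real Banach algebra: generators, Killing form, exponential -/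

/-- The `sl(2, ℝ)`-matrices `J_0, J_1, J_2`. -/
def Jmat : Fin 3 → Matrix (Fin 2) (Fin 2) ℝ :=
  ![(1 / 2 : ℝ) • !![0, -1; 1, 0], (1 / 2 : ℝ) • !![1, 0; 0, -1], (1 / 2 : ℝ) • !![0, 1; 1, 0]]

/-- The traceless matrices `sl(2, R)`. -/
abbrev sl2 (R : Type) [CommRing R] := LieAlgebra.SpecialLinear.sl (Fin 2) R

/-- The element `v^a J_a` of `sl(2, R)` for `v ∈ R³`. -/
def slJ {R : Type} [CommRing R] [Algebra ℝ R] (v : Fin 3 → R) : sl2 R :=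
  ⟨∑ a, v a • (Jmat a).map (algebraMap ℝ R), by
    change Matrix.trace (∑ a, v a • (Jmat a).map (algebraMap ℝ R)) = 0
    simp [Fin.sum_univ_three, Jmat, Matrix.trace_fin_two]⟩

/-- The form `g_K(X, Y) = Tr (X Y)` on `sl(2, R)`, the `R`-bilinear extension of
`g_K(J_a, J_b) = η_{ab} / 2`. -/
def gK (R : Type) [CommRing R] : LinearMap.BilinForm R (sl2 R) :=
  LinearMap.mk₂ R (fun X Y => Matrix.trace (X.1 * Y.1))
    (fun X X' Y => by simp [add_mul]) (fun c X Y => by simp)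
    (fun X Y Y' => by simp [mul_add]) (fun c X Y => by simp)

theorem adjugate_eq_neg {R : Type} [CommRing R] (X : sl2 R) :
    Matrix.adjugate X.1 = -X.1 := by
  have h : X.1.trace = 0 := X.2
  rw [Matrix.trace_fin_two] at h
  rw [Matrix.adjugate_fin_two]
  ext i j
  fin_cases i <;> fin_cases j <;> simp
  · exact (neg_eq_of_add_eq_zero_right h).symm
  · exact (neg_eq_of_add_eq_zero_left h).symm

section exponential

variable {R : Type} [NormedCommRing R] [NormedAlgebra ℝ R] [CompleteSpace R]

/-- The exponential of a traceless `2 × 2` matrix has determinant one. -/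
theorem det_exp_sl2 (X : sl2 R) : (NormedSpace.exp X.1).det = 1 := by
  let _ : NormedAlgebra ℚ R := NormedAlgebra.restrictScalars ℚ ℝ R
  have hW : (!![0, 1; -1, 0] : Matrix (Fin 2) (Fin 2) R) * !![0, -1; 1, 0] = 1 := by
    ext i j
    fin_cases i <;> fin_cases j <;> simp
  have hinv : (!![0, 1; -1, 0] : Matrix (Fin 2) (Fin 2) R)⁻¹ = !![0, -1; 1, 0] :=
    Matrix.inv_eq_right_inv hW
  have hunit : IsUnit (!![0, 1; -1, 0] : Matrix (Fin 2) (Fin 2) R) :=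
    (Matrix.isUnit_iff_isUnit_det _).mpr (by simp)
  have hadj : ∀ M : Matrix (Fin 2) (Fin 2) R,
      !![0, 1; -1, 0] * Mᵀ * !![0, -1; 1, 0] = M.adjugate := fun M => by
    rw [Matrix.adjugate_fin_two]
    ext i j
    fin_cases i <;> fin_cases j <;>
      simp [Matrix.mul_apply, Matrix.vecMul, dotProduct, Fin.sum_univ_two]
  have h1 := Matrix.exp_conj _ X.1ᵀ hunit
  rw [hinv, hadj, Matrix.exp_transpose, hadj, adjugate_eq_neg] at h1
  have h2 : NormedSpace.exp X.1 * NormedSpace.exp (-X.1) = 1 := by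
    rw [← Matrix.exp_add_of_commute _ _ (Commute.refl X.1).neg_right, add_neg_cancel,
      NormedSpace.exp_zero]
  rw [h1, Matrix.mul_adjugate] at h2
  simpa using congrFun (congrFun h2 0) 0

/-- The exponential `∑ Xⁿ / n!` from `sl(2, R)` to `SL(2, R)`. -/
def expSL (X : sl2 R) : SL(2, R) := ⟨NormedSpace.exp X.1, det_exp_sl2 X⟩

/-- The exponential map from `sl(2, R)` to `PSL(2, R)`, the quotient of `SL(2, R)` by its centre
`{c • 1 | c ^ 2 = 1}`. -/
def expPSL (X : sl2 R) : PSL(2, R) := QuotientGroup.mk (expSL X)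

end exponential

/-! ### The Lie algebra `𝔥_Λ` and its bilinear forms -/

/-- The six-dimensional real Lie algebra `𝔥_Λ`; the pair `(p, k)` of vectors in `ℝ³`
stands for `p^a J_a + k^a P_a`. -/
def hAlg (_Λ : ℝ) : Type := (Fin 3 → ℝ) × (Fin 3 → ℝ)

instance instNormedAddCommGroupH (Λ : ℝ) : NormedAddCommGroup (hAlg Λ) :=
  inferInstanceAs (NormedAddCommGroup ((Fin 3 → ℝ) × (Fin 3 → ℝ)))

instance instNormedSpaceH (Λ : ℝ) : NormedSpace ℝ (hAlg Λ) :=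
  inferInstanceAs (NormedSpace ℝ ((Fin 3 → ℝ) × (Fin 3 → ℝ)))

/-- The vector `p` of `p^a J_a + k^a P_a`. -/
def hAlg.p {Λ : ℝ} (x : hAlg Λ) : Fin 3 → ℝ := Prod.fst (α := Fin 3 → ℝ) (β := Fin 3 → ℝ) x

/-- The vector `k` of `p^a J_a + k^a P_a`. -/
def hAlg.k {Λ : ℝ} (x : hAlg Λ) : Fin 3 → ℝ := Prod.snd (α := Fin 3 → ℝ) (β := Fin 3 → ℝ) x

/-- The element `p^a J_a + k^a P_a`. -/
def hAlg.mk {Λ : ℝ} (p k : Fin 3 → ℝ) : hAlg Λ := ((p, k) : (Fin 3 → ℝ) × (Fin 3 → ℝ))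

theorem hAlg.ext {Λ : ℝ} {x y : hAlg Λ} (hp : x.p = y.p) (hk : x.k = y.k) : x = y :=
  Prod.ext hp hk

@[simp] theorem mk_p (Λ : ℝ) (p k : Fin 3 → ℝ) : (hAlg.mk p k : hAlg Λ).p = p := rfl

@[simp] theorem mk_k (Λ : ℝ) (p k : Fin 3 → ℝ) : (hAlg.mk p k : hAlg Λ).k = k := rfl

@[simp] theorem add_p (Λ : ℝ) (x y : hAlg Λ) : (x + y).p = x.p + y.p := rfl

@[simp] theorem add_k (Λ : ℝ) (x y : hAlg Λ) : (x + y).k = x.k + y.k := rfl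

@[simp] theorem zero_p (Λ : ℝ) : (0 : hAlg Λ).p = 0 := rfl

@[simp] theorem zero_k (Λ : ℝ) : (0 : hAlg Λ).k = 0 := rfl

@[simp] theorem smul_p (Λ : ℝ) (t : ℝ) (x : hAlg Λ) : (t • x).p = t • x.p := rfl

@[simp] theorem smul_k (Λ : ℝ) (t : ℝ) (x : hAlg Λ) : (t • x).k = t • x.k := rfl

/-- The basis `J_0, J_1, J_2, P_0, P_1, P_2` of `𝔥_Λ`. -/
def hBasis (Λ : ℝ) : Module.Basis (Fin 3 ⊕ Fin 3) ℝ (hAlg Λ) :=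
  (Pi.basisFun ℝ (Fin 3)).prod (Pi.basisFun ℝ (Fin 3))

instance instFiniteH (Λ : ℝ) : Module.Finite ℝ (hAlg Λ) := Module.Finite.of_basis (hBasis Λ)

/-- `J_a` as an element of `𝔥_Λ`. -/
def hJ (Λ : ℝ) (a : Fin 3) : hAlg Λ := hAlg.mk (Pi.single a 1) 0

/-- `P_a` as an element of `𝔥_Λ`. -/
def hP (Λ : ℝ) (a : Fin 3) : hAlg Λ := hAlg.mk 0 (Pi.single a 1)

theorem hBasis_inl (Λ : ℝ) (a : Fin 3) : hBasis Λ (Sum.inl a) = hJ Λ a := by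
  refine hAlg.ext ?_ ?_
  · exact (Module.Basis.prod_apply_inl_fst (Pi.basisFun ℝ (Fin 3)) (Pi.basisFun ℝ (Fin 3)) a).trans
      (Pi.basisFun_apply ℝ (Fin 3) a)
  · exact Module.Basis.prod_apply_inl_snd (Pi.basisFun ℝ (Fin 3)) (Pi.basisFun ℝ (Fin 3)) a

theorem hBasis_inr (Λ : ℝ) (a : Fin 3) : hBasis Λ (Sum.inr a) = hP Λ a := by
  refine hAlg.ext ?_ ?_
  · exact Module.Basis.prod_apply_inr_fst (Pi.basisFun ℝ (Fin 3)) (Pi.basisFun ℝ (Fin 3)) a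
  · exact (Module.Basis.prod_apply_inr_snd (Pi.basisFun ℝ (Fin 3)) (Pi.basisFun ℝ (Fin 3)) a).trans
      (Pi.basisFun_apply ℝ (Fin 3) a)

/-- The Minkowski metric `-p⁰q⁰ + p¹q¹ + p²q²`. -/
def eta (p q : Fin 3 → ℝ) : ℝ := -(p 0 * q 0) + p 1 * q 1 + p 2 * q 2

/-- `(p × q)^c = p^a q^b ε_{ab}{}^c`, with `ε_{012} = 1` and the index raised by the Minkowski
metric. -/
def lcross (p q : Fin 3 → ℝ) : Fin 3 → ℝ :=
  ![-(p 1 * q 2 - p 2 * q 1), p 2 * q 0 - p 0 * q 2, p 0 * q 1 - p 1 * q 0]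

/-- `[J_a, J_b] = ε_{ab}{}^c J_c`, `[J_a, P_b] = ε_{ab}{}^c P_c`, `[P_a, P_b] = Λ ε_{ab}{}^c J_c`. -/
instance instBracketH (Λ : ℝ) : Bracket (hAlg Λ) (hAlg Λ) where
  bracket x y := hAlg.mk (lcross x.p y.p + Λ • lcross x.k y.k) (lcross x.p y.k + lcross x.k y.p)

@[simp] theorem bracket_p (Λ : ℝ) (x y : hAlg Λ) :
    (⁅x, y⁆ : hAlg Λ).p = lcross x.p y.p + Λ • lcross x.k y.k := rfl

@[simp] theorem bracket_k (Λ : ℝ) (x y : hAlg Λ) :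
    (⁅x, y⁆ : hAlg Λ).k = lcross x.p y.k + lcross x.k y.p := rfl

instance instLieRingH (Λ : ℝ) : LieRing (hAlg Λ) where
  add_lie x y z := by
    apply hAlg.ext <;> ext i <;> fin_cases i <;> simp [lcross] <;> ring
  lie_add x y z := by
    apply hAlg.ext <;> ext i <;> fin_cases i <;> simp [lcross] <;> ring
  lie_self x := by
    apply hAlg.ext <;> ext i <;> fin_cases i <;> simp [lcross] <;> ring
  leibniz_lie x y z := by
    apply hAlg.ext <;> ext i <;> fin_cases i <;> simp [lcross] <;> ring

instance instLieAlgebraH (Λ : ℝ) : LieAlgebra ℝ (hAlg Λ) where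
  lie_smul t x y := by
    apply hAlg.ext <;> ext i <;> fin_cases i <;> simp [lcross] <;> ring

/-- The form `⟨J_a, P_b⟩ = η_{ab}`, `⟨J_a, J_b⟩ = ⟨P_a, P_b⟩ = 0`. -/
def pairing (Λ : ℝ) : LinearMap.BilinForm ℝ (hAlg Λ) :=
  LinearMap.mk₂ ℝ (fun x y => eta x.p y.k + eta x.k y.p)
    (fun x x' y => by simp [eta]; ring) (fun c x y => by simp [eta]; ring)
    (fun x y y' => by simp [eta]; ring) (fun c x y => by simp [eta]; ring)

/-- The form `κ(J_a, J_b) = η_{ab}`, `κ(J_a, P_b) = 0`, `κ(P_a, P_b) = Λ η_{ab}`. -/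
def kap (Λ : ℝ) : LinearMap.BilinForm ℝ (hAlg Λ) :=
  LinearMap.mk₂ ℝ (fun x y => eta x.p y.p + Λ * eta x.k y.k)
    (fun x x' y => by simp [eta]; ring) (fun c x y => by simp [eta]; ring)
    (fun x y y' => by simp [eta]; ring) (fun c x y => by simp [eta]; ring)

theorem pairing_nondegenerate (Λ : ℝ) : (pairing Λ).Nondegenerate := by
  have hsymm : ∀ x y, pairing Λ x y = pairing Λ y x := fun x y => by
    simp only [pairing, LinearMap.mk₂_apply, eta]
    ring
  have hl : ∀ x : hAlg Λ, (∀ y, pairing Λ x y = 0) → x = 0 := fun x hx => by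
    have h1 : ∀ q, eta x.p q = 0 := fun q => by
      have h := hx (hAlg.mk 0 q)
      change eta x.p q + eta x.k 0 = 0 at h
      simpa [eta] using h
    have h2 : ∀ q, eta x.k q = 0 := fun q => by
      have h := hx (hAlg.mk q 0)
      change eta x.p 0 + eta x.k q = 0 at h
      simpa [eta] using h
    have h3 : ∀ p : Fin 3 → ℝ, (∀ q, eta p q = 0) → p = 0 := fun p hp => by
      ext i
      have := hp (Pi.single i 1)
      fin_cases i <;> simpa [eta] using this
    exact hAlg.ext (h3 _ h1) (h3 _ h2)
  exact ⟨hl, fun y hy => hl y fun x => (hsymm y x).trans (hy x)⟩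

/-- The element of `𝔥_Λ` that represents a linear functional through `⟨ , ⟩`. -/
def dualVec (Λ : ℝ) : Module.Dual ℝ (hAlg Λ) ≃ₗ[ℝ] hAlg Λ :=
  ((pairing Λ).toDual (pairing_nondegenerate Λ)).symm

/-- The linear map `l_β` of a bilinear form `β`, determined by `⟨l_β x, y⟩ = β x y`. -/
def lMap {Λ : ℝ} (β : LinearMap.BilinForm ℝ (hAlg Λ)) : hAlg Λ →ₗ[ℝ] hAlg Λ :=
  (dualVec Λ).toLinearMap ∘ₗ β

theorem pairing_lMap {Λ : ℝ} (β : LinearMap.BilinForm ℝ (hAlg Λ)) (x y : hAlg Λ) :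
    pairing Λ (lMap β x) y = β x y := by
  simp [lMap, dualVec]

/-- The identification of `𝔥_Λ` with `sl(2, R_Λ)`:
`p^a J_a + k^a P_a` corresponds to `(p^a + Θ k^a) J_a`. -/
def toSl {Λ : ℝ} (x : hAlg Λ) : sl2 (RL Λ) := slJ (fun a => (⟨x.p a, x.k a⟩ : RL Λ))

/-! ### The gauge group, logarithms and the functions `G` -/

/-- The gauge group `Isom(X_Λ)` in its matrix form `PSL(2, R_Λ)`. -/
abbrev Isom (Λ : ℝ) : Type := PSL(2, RL Λ)

/-- The exponential map from `𝔥_Λ` to the gauge group. -/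
def expIsom {Λ : ℝ} (x : hAlg Λ) : Isom Λ := expPSL (toSl x)

/-- A local parametrisation of the gauge group by the exponential map: on the domain `dom`, open
along all left-invariant vector fields, `log` is a right inverse of the exponential map that is
differentiable along these vector fields. Every smooth local inverse of the exponential map on an
open set is an example. -/
structure LogBranch (Λ : ℝ) where
  dom : Set (Isom Λ)
  log : Isom Λ → hAlg Λ
  exp_log : ∀ u ∈ dom, expIsom (log u) = u
  dom_open : ∀ u ∈ dom, ∀ Y : hAlg Λ, ∀ᶠ s : ℝ in 𝓝 0, u * expIsom (s • Y) ∈ dom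
  log_diff : ∀ u ∈ dom, ∀ Y : hAlg Λ,
    DifferentiableAt ℝ (fun s : ℝ => log (u * expIsom (s • Y))) 0

namespace LogBranch

variable {Λ : ℝ} (b : LogBranch Λ)

/-- The function `exp x ↦ β(x, x) / 2` on the gauge group given by a real bilinear form. -/
def formFun (β : LinearMap.BilinForm ℝ (hAlg Λ)) (u : Isom Λ) : ℝ :=
  (1 / 2) * β (b.log u) (b.log u)

/-- The function `κ̃`. -/
def kapTilde : Isom Λ → ℝ := b.formFun (kap Λ)

/-- The function `t̃`, given by the form `⟨ , ⟩`. -/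
def tTilde : Isom Λ → ℝ := b.formFun (pairing Λ)

/-- The `R_Λ`-valued function `exp x ↦ g_K(x, x) / 2`. -/
def gKTilde (u : Isom Λ) : RL Λ :=
  (1 / 2 : ℝ) • gK (RL Λ) (toSl (b.log u)) (toSl (b.log u))

/-- The power `u ^ s = exp (s log u)` with exponent `s ∈ R_Λ`. -/
def pow (s : RL Λ) (u : Isom Λ) : Isom Λ := expPSL (s • toSl (b.log u))

end LogBranch

/-- The derivative `d/ds f(u exp(s Y))` at `s = 0` along a left-invariant vector field. -/
def rDeriv {Λ : ℝ} (f : Isom Λ → ℝ) (u : Isom Λ) (Y : hAlg Λ) : ℝ :=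
  deriv (fun s : ℝ => f (u * expIsom (s • Y))) 0

/-- The element `g_f(u) ∈ 𝔥_Λ` with `⟨g_f(u), T_a⟩ = R_a f(u)` for the basis `T_a` of `𝔥_Λ`. -/
def gVec {Λ : ℝ} (f : Isom Λ → ℝ) (u : Isom Λ) : hAlg Λ :=
  dualVec Λ ((hBasis Λ).constr ℝ fun a => rDeriv f u (hBasis Λ a))

theorem pairing_gVec {Λ : ℝ} (f : Isom Λ → ℝ) (u : Isom Λ) (a : Fin 3 ⊕ Fin 3) :
    pairing Λ (gVec f u) (hBasis Λ a) = rDeriv f u (hBasis Λ a) := by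
  simp [gVec, dualVec]

/-- The function `G_f^s(u) = exp(s g_f(u))` with parameter `s ∈ R_Λ`, which acts on
`𝔥_Λ = sl(2, R_Λ)`; a real parameter `t` is the element `t + Θ 0` of `R_Λ`. -/
def GMap {Λ : ℝ} (f : Isom Λ → ℝ) (s : RL Λ) (u : Isom Λ) : Isom Λ :=
  expPSL (s • toSl (gVec f u))

/-! ### Holonomies, curves and the transformations `T` -/

section surface

variable {g : ℕ} {P : Type} [Group P]

/-- `H_i = [B_i, A_i⁻¹] = B_i A_i⁻¹ B_i⁻¹ A_i`. -/
def Hcomm (A B : Fin g → P) (i : Fin g) : P := B i * (A i)⁻¹ * (B i)⁻¹ * A i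

/-- The product `H_m ⋯ H_1` of the first `m` commutators, later factors on the left. -/
def Hprod (A B : Fin g → P) (m : ℕ) : P := ((List.ofFn (Hcomm A B)).take m).reverse.prod

/-- Holonomies of the dual generators: `Sum.inl i` stands for
`å_i = h_1⁻¹ ⋯ h_i⁻¹ b_i h_{i-1} ⋯ h_1` and `Sum.inr i` for
`b̊_i = h_1⁻¹ ⋯ h_i⁻¹ a_i h_{i-1} ⋯ h_1`. -/
def dualHol (A B : Fin g → P) : Fin g ⊕ Fin g → P
  | Sum.inl i => (Hprod A B (i + 1))⁻¹ * B i * Hprod A B i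
  | Sum.inr i => (Hprod A B (i + 1))⁻¹ * A i * Hprod A B i

/-- A word `x_r^{α_r} ∘ ⋯ ∘ x_1^{α_1}` in the dual generators, as the list of the pairs
`(x_1, α_1), …, (x_r, α_r)`. -/
abbrev DualWord (g : ℕ) : Type := List ((Fin g ⊕ Fin g) × ℤˣ)

/-- The holonomy `X_r^{α_r} ⋯ X_1^{α_1}` of a word. -/
def wordHol (A B : Fin g → P) (w : DualWord g) : P :=
  (w.map fun l => dualHol A B l.1 ^ (l.2 : ℤ)).reverse.prod

end surface

/-- A curve `η` on the surface of genus `g`: a word in the dual generators, together with, for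
each generator `a_i` (index `Sum.inl i`) or `b_i` (index `Sum.inr i`), the list of the positions
`k` with `x_k = å_i` or `x_k = b̊_i`, which are the intersection points of `η` with that generator,
in the order in which they occur on it. -/
structure CurveData (g : ℕ) where
  word : DualWord g
  order : Fin g ⊕ Fin g → List (Fin word.length)
  nodup : ∀ y, (order y).Nodup
  mem_order : ∀ y k, k ∈ order y ↔ (word.get k).1 = y

namespace CurveData

variable {g : ℕ} (η : CurveData g)

/-- The exponent `α_k`. -/
def sign (k : Fin η.word.length) : ℤˣ := (η.word.get k).2

/-- The cyclic permutation `η_k`: it starts with `x_k` if `α_k = 1`, and with the factor after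
`x_k` if `α_k = -1`. -/
def cyc (k : Fin η.word.length) : DualWord g :=
  if η.sign k = 1 then η.word.rotate k else η.word.rotate (k + 1)

/-- The observable `f_η : (A_1, …, B_g) ↦ f(H_η)`. -/
def wilson {P E : Type} [Group P] (f : P → E) (AB : (Fin g → P) × (Fin g → P)) : E :=
  f (wordHol AB.1 AB.2 η.word)

/-- The ordered product of the factors `G_f^{-s α_k}(H_{η_k})` over the intersection points with
the generator `y`, ordered from the right to the left. -/
def factor {Λ : ℝ} (f : Isom Λ → ℝ) (s : RL Λ) (AB : (Fin g → Isom Λ) × (Fin g → Isom Λ))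
    (y : Fin g ⊕ Fin g) : Isom Λ :=
  ((η.order y).map fun k =>
    GMap f (-(s * (((η.sign k : ℤˣ) : ℤ) : RL Λ))) (wordHol AB.1 AB.2 (η.cyc k))).reverse.prod

/-- The transformation `T_{f,η}^s` of the holonomies with parameter `s ∈ R_Λ`:
`A_i ↦ A_i (H_{i-1} ⋯ H_1) ∏ G_f^{-s α_k}(H_{η_k}) (H_{i-1} ⋯ H_1)⁻¹` and
`B_i ↦ B_i (B_i⁻¹ A_i H_{i-1} ⋯ H_1) ∏ G_f^{-s α_k}(H_{η_k}) (B_i⁻¹ A_i H_{i-1} ⋯ H_1)⁻¹`. -/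
def T {Λ : ℝ} (f : Isom Λ → ℝ) (s : RL Λ) (AB : (Fin g → Isom Λ) × (Fin g → Isom Λ)) :
    (Fin g → Isom Λ) × (Fin g → Isom Λ) :=
  (fun i => AB.1 i * (Hprod AB.1 AB.2 i * η.factor f s AB (Sum.inl i) *
      (Hprod AB.1 AB.2 i)⁻¹),
   fun i => AB.2 i * (((AB.2 i)⁻¹ * AB.1 i * Hprod AB.1 AB.2 i) *
      η.factor f s AB (Sum.inr i) * ((AB.2 i)⁻¹ * AB.1 i * Hprod AB.1 AB.2 i)⁻¹))

end CurveData

/-! ### The isometry groups of the model spacetimes -/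

/-- The matrix `u X u⁻¹`. -/
def adFun (u : SL(2, ℝ)) (X : sl2 ℝ) : sl2 ℝ :=
  ⟨(u : Matrix (Fin 2) (Fin 2) ℝ) * X.1 * ((u⁻¹ : SL(2, ℝ)) : Matrix (Fin 2) (Fin 2) ℝ), by
    have hX : Matrix.trace X.1 = 0 := X.2
    change Matrix.trace ((u : Matrix (Fin 2) (Fin 2) ℝ) * X.1 *
      ((u⁻¹ : SL(2, ℝ)) : Matrix (Fin 2) (Fin 2) ℝ)) = 0
    rw [Matrix.trace_mul_comm, ← mul_assoc, ← Matrix.SpecialLinearGroup.coe_mul, inv_mul_cancel,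
      Matrix.SpecialLinearGroup.coe_one, one_mul, hX]⟩

theorem adFun_one (X : sl2 ℝ) : adFun 1 X = X := Subtype.ext (by simp [adFun])

theorem adFun_mul (u v : SL(2, ℝ)) (X : sl2 ℝ) : adFun (u * v) X = adFun u (adFun v X) :=
  Subtype.ext (by simp only [adFun, _root_.mul_inv_rev, Matrix.SpecialLinearGroup.coe_mul, mul_assoc])

/-- The adjoint action `X ↦ u X u⁻¹` of `SL(2, ℝ)` on `sl(2, ℝ)`. -/
def adSL : SL(2, ℝ) →* MulAut (Multiplicative (sl2 ℝ)) where
  toFun u := AddEquiv.toMultiplicative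
    { toFun := adFun u
      invFun := adFun u⁻¹
      left_inv := fun X => by rw [← adFun_mul, inv_mul_cancel, adFun_one]
      right_inv := fun X => by rw [← adFun_mul, mul_inv_cancel, adFun_one]
      map_add' := fun X Y => Subtype.ext (by simp [adFun, mul_add, add_mul]) }
  map_one' := MulEquiv.ext fun X => adFun_one X.toAdd
  map_mul' u v := MulEquiv.ext fun X => adFun_mul u v X.toAdd

/-- The adjoint action of `PSL(2, ℝ)` on `sl(2, ℝ)`. -/
def adPSL : PSL(2, ℝ) →* MulAut (Multiplicative (sl2 ℝ)) :=
  QuotientGroup.lift _ adSL fun u hu => MulEquiv.ext fun X => Subtype.ext (by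
    obtain ⟨r, -, hr⟩ := Matrix.SpecialLinearGroup.mem_center_iff.mp hu
    change (u : Matrix (Fin 2) (Fin 2) ℝ) * (X.toAdd : sl2 ℝ).1 *
      ((u⁻¹ : SL(2, ℝ)) : Matrix (Fin 2) (Fin 2) ℝ) = (X.toAdd : sl2 ℝ).1
    have hc : (u : Matrix (Fin 2) (Fin 2) ℝ) * (X.toAdd : sl2 ℝ).1 =
        (X.toAdd : sl2 ℝ).1 * (u : Matrix (Fin 2) (Fin 2) ℝ) := by
      rw [← hr]
      exact (Matrix.scalar_commute r (fun r' => mul_comm r r') _)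
    rw [hc, mul_assoc, ← Matrix.SpecialLinearGroup.coe_mul, mul_inv_cancel,
      Matrix.SpecialLinearGroup.coe_one, mul_one])

/-- The (2+1)-dimensional Poincaré group `PSL(2, ℝ) ⋉ ℝ³`, `ℝ³ = sl(2, ℝ)`, with
`(u, a) (v, b) = (u v, a + Ad(u) b)`. -/
abbrev Poincare : Type := Multiplicative (sl2 ℝ) ⋊[adPSL] PSL(2, ℝ)

/-- `T(p) k = ∑ ad_p ^ n (k) / (n + 1)!`. -/
def Tser (p k : sl2 ℝ) : sl2 ℝ :=
  ∑' n : ℕ, ((n + 1)! : ℝ)⁻¹ • ((LieAlgebra.ad ℝ (sl2 ℝ) p) ^ n) k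

end Grafting

end

/-! Everything rests on one fact: under `toSl`, the map `l_κ` is multiplication by `Θ`. The real and
`Θ`-components of the single `R_Λ`-bilinear form `Tr(XY)` are `κ/2` and `⟨ , ⟩/2`, so `κ(x, y) =
⟨Θx, y⟩`.

The analytic input is the gradient of `½β(log u, log u)`. For `x(s) = log(u exp(sY))`, differentiate
`exp x(s) = u exp(sY)`. The derivative of `exp` at `x` is complicated, but after multiplication by
an element commuting with `x` and under a trace it acts like multiplication by `eˣ`
(`trace_fderiv_exp`). Hence `Tr(x x') = Tr(x Y)` in `R_Λ` (`gK_deriv_log`), and its two components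
give both gradients at once: `log u` for `t̃` and `Θ log u` for `κ̃`. Since logarithms are taken in
`PSL`, the curve first has to be lifted to `SL`, where the central ambiguity is excluded near `s =
0` (`exp_eventuallyEq_of_expIsom`).

Thus `G_κ̃^t = exp(tΘ log) = G_t̃^{tΘ}`. Grafting and Dehn twist are built from these factors by the
same formula, so they agree factor by factor.

The model groups come from the ring: `R_Λ` is `ℝ × ℝ` for `Λ > 0` through `Θ ↦ ±√Λ`, and `ℂ` for `Λ
< 0` through `Θ ↦ i√|Λ|`. For `Λ = 0` it is the ring of dual numbers, and `A + ΘB ↦ (BA⁻¹, A)` gives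
the semidirect product. There the exponential is found by solving `G' = k + [p, G]`
(`exists_ad_flow`, `exp_add_central_mul`). -/

noncomputable section

namespace Grafting

/-! ### The Lie algebra as `sl(2, R_Λ)` and its forms -/

theorem slJ_val {R : Type} [CommRing R] [Algebra ℝ R] (v : Fin 3 → R) :
    (slJ v).1 = algebraMap ℝ R (1 / 2) • !![v 1, v 2 - v 0; v 0 + v 2, -v 1] := by
  ext i j
  fin_cases i <;> fin_cases j <;>
    simp [slJ, Jmat, Fin.sum_univ_three] <;> ring

theorem slJ_smul {R : Type} [CommRing R] [Algebra ℝ R] (c : R) (v : Fin 3 → R) :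
    slJ (c • v) = c • slJ v :=
  Subtype.ext (by
    change ∑ a, (c • v) a • (Jmat a).map (algebraMap ℝ R) =
      c • ∑ a, v a • (Jmat a).map (algebraMap ℝ R)
    simp only [Finset.smul_sum, smul_smul, Pi.smul_apply, smul_eq_mul])

theorem slJ_add {R : Type} [CommRing R] [Algebra ℝ R] (v w : Fin 3 → R) :
    slJ (v + w) = slJ v + slJ w :=
  Subtype.ext (by
    change ∑ a, (v + w) a • (Jmat a).map (algebraMap ℝ R) =
      ∑ a, v a • (Jmat a).map (algebraMap ℝ R) + ∑ a, w a • (Jmat a).map (algebraMap ℝ R)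
    simp only [Pi.add_apply, add_smul, Finset.sum_add_distrib])

theorem algebraMap_half_mul_two (R : Type) [CommRing R] [Algebra ℝ R] :
    algebraMap ℝ R (1 / 2) * 2 = 1 := by
  rw [← map_ofNat (algebraMap ℝ R) 2, ← map_mul]
  norm_num

theorem slJ_bijective (R : Type) [CommRing R] [Algebra ℝ R] :
    Function.Bijective (slJ : (Fin 3 → R) → sl2 R) := by
  have h2 := algebraMap_half_mul_two R
  set c := algebraMap ℝ R (1 / 2) with hc
  constructor
  · intro v w h
    have h' := congrArg Subtype.val h
    rw [slJ_val, slJ_val, ← hc] at h'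
    have e00 := congrFun (congrFun h' 0) 0
    have e01 := congrFun (congrFun h' 0) 1
    have e10 := congrFun (congrFun h' 1) 0
    simp at e00 e01 e10
    ext i
    fin_cases i
    · change v 0 = w 0
      linear_combination e10 - e01 + (w 0 - v 0) * h2
    · change v 1 = w 1
      linear_combination 2 * e00 + (w 1 - v 1) * h2
    · change v 2 = w 2
      linear_combination e10 + e01 + (w 2 - v 2) * h2
  · intro X
    -- The coordinates are read off by inverting the explicit matrix of `slJ_val`.
    refine ⟨![X.1 1 0 - X.1 0 1, 2 * X.1 0 0, X.1 0 1 + X.1 1 0], Subtype.ext ?_⟩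
    have ht : X.1 0 0 + X.1 1 1 = 0 := by
      rw [← Matrix.trace_fin_two]
      exact X.2
    rw [slJ_val, ← hc]
    ext i j
    fin_cases i <;> fin_cases j <;> simp
    · linear_combination X.1 0 0 * h2
    · linear_combination X.1 0 1 * h2
    · linear_combination X.1 1 0 * h2
    · linear_combination -X.1 0 0 * h2 - ht

section algebra

variable {Λ : ℝ}

@[simp] theorem re_algebraMap (t : ℝ) : (algebraMap ℝ (RL Λ) t).re = t := rfl

@[simp] theorem im_algebraMap (t : ℝ) : (algebraMap ℝ (RL Λ) t).im = 0 := rfl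

theorem toSl_bijective : Function.Bijective (toSl (Λ := Λ)) := by
  refine (slJ_bijective (RL Λ)).comp ⟨fun x y h => ?_, fun v => ?_⟩
  · refine hAlg.ext (funext fun a => ?_) (funext fun a => ?_)
    · exact congrArg QuadraticAlgebra.re (congrFun h a)
    · exact congrArg QuadraticAlgebra.im (congrFun h a)
  · exact ⟨hAlg.mk (fun a => (v a).re) (fun a => (v a).im), rfl⟩

theorem toSl_add (x y : hAlg Λ) : toSl (x + y) = toSl x + toSl y := by
  rw [toSl, toSl, toSl, ← slJ_add]
  rfl

theorem toSl_real_smul (t : ℝ) (x : hAlg Λ) :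
    toSl (t • x) = algebraMap ℝ (RL Λ) t • toSl x := by
  rw [toSl, toSl, ← slJ_smul]
  congr 1
  ext a <;> simp

/-- Expansion of `(s₀ + Θs₁)(p + Θk)` with `Θ² = Λ`. It moves the `R_Λ`-action back to the real
coordinates of `hAlg`. -/
theorem toSl_smul (s : RL Λ) (x : hAlg Λ) :
    s • toSl x = toSl (hAlg.mk (s.re • x.p + (Λ * s.im) • x.k) (s.re • x.k + s.im • x.p)) := by
  rw [toSl, toSl, ← slJ_smul]
  congr 1
  ext a <;> simp

theorem toSl_lie (x y : hAlg Λ) : toSl ⁅x, y⁆ = ⁅toSl x, toSl y⁆ := by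
  refine Subtype.ext ?_
  change _ = (toSl x).1 * (toSl y).1 - (toSl y).1 * (toSl x).1
  rw [toSl, toSl, toSl, slJ_val, slJ_val, slJ_val]
  ext i j <;> fin_cases i <;> fin_cases j <;>
    simp [lcross] <;> ring

theorem toSl_hP (a : Fin 3) : toSl (hP Λ a) = Θ Λ • toSl (hJ Λ a) := by
  rw [toSl_smul]
  congr 1
  refine hAlg.ext ?_ ?_ <;> simp [hP, hJ, Θ]

theorem gK_toSl (x y : hAlg Λ) :
    gK (RL Λ) (toSl x) (toSl y) =
      algebraMap ℝ (RL Λ) (1 / 2 * kap Λ x y) + Θ Λ * algebraMap ℝ (RL Λ) (1 / 2 * pairing Λ x y) := by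
  change Matrix.trace ((toSl x).1 * (toSl y).1) = _
  rw [toSl, toSl, slJ_val, slJ_val, Matrix.trace_fin_two]
  ext <;> simp [Matrix.mul_apply, kap, pairing, eta, Θ] <;> ring

theorem ext_pairing {x y : hAlg Λ} (h : ∀ z, pairing Λ x z = pairing Λ y z) : x = y := by
  refine sub_eq_zero.mp ((pairing_nondegenerate Λ).1 _ fun z => ?_)
  rw [map_sub, LinearMap.sub_apply, h z, sub_self]

theorem lMap_pairing : lMap (pairing Λ) = LinearMap.id :=
  LinearMap.ext fun x => ext_pairing fun z => pairing_lMap _ x z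

/-- The pairing crosses `p` with `k` while `κ` does not, so the representing vector swaps the two
slots. The result is the coordinate form of `Θ(p + Θk)`. -/
theorem lMap_kap (x : hAlg Λ) : lMap (kap Λ) x = hAlg.mk (Λ • x.k) x.p := by
  refine ext_pairing fun z => ?_
  rw [pairing_lMap]
  simp [kap, pairing, eta]
  ring

theorem toSl_lMap_kap (x : hAlg Λ) : toSl (lMap (kap Λ) x) = Θ Λ • toSl x := by
  rw [lMap_kap, toSl_smul]
  congr 1
  refine hAlg.ext ?_ ?_ <;> simp [Θ]

end algebra

/-! ### The derivative of the exponential under a trace -/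

section traceExp

open NormedSpace

variable {A B : Type*} [NormedRing A] [NormedAlgebra ℝ A] [NormedAddCommGroup B] [NormedSpace ℝ B]

/-- The derivative of the term `xⁿ / n!` of the exponential series. -/
def expTermDeriv (x : A) (n : ℕ) : A →L[ℝ] A :=
  -- For `n = 0` the sum is empty, so the value of `n.pred` there is irrelevant.
  (n ! : ℝ)⁻¹ • ∑ i ∈ Finset.range n,
    ContinuousLinearMap.mulLeftRight ℝ A (x ^ (n.pred - i)) (x ^ i)

theorem expTermDeriv_apply (x z : A) (n : ℕ) :
    expTermDeriv x n z =
      (n ! : ℝ)⁻¹ • ∑ i ∈ Finset.range n, x ^ (n.pred - i) * z * x ^ i := by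
  simp [expTermDeriv]

theorem hasFDerivAt_expTerm (x : A) (n : ℕ) :
    HasFDerivAt (fun y : A => (n ! : ℝ)⁻¹ • y ^ n) (expTermDeriv x n) x := by
  have h := (hasFDerivAt_id (𝕜 := ℝ) x).pow' n
  refine (h.const_smul (n ! : ℝ)⁻¹).congr_fderiv ?_
  ext z
  simp [expTermDeriv, mul_assoc]

variable [NormOneClass A]

theorem norm_expTermDeriv_le {x : A} {r : ℝ} (hx : ‖x‖ ≤ r) (n : ℕ) :
    ‖expTermDeriv x n‖ ≤ (n ! : ℝ)⁻¹ * (n * r ^ n.pred) := by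
  rw [expTermDeriv, norm_smul, norm_inv, Real.norm_natCast]
  gcongr
  refine (norm_sum_le _ _).trans ?_
  have h : ∀ i ∈ Finset.range n,
      ‖ContinuousLinearMap.mulLeftRight ℝ A (x ^ (n.pred - i)) (x ^ i)‖ ≤ r ^ n.pred := by
    intro i hi
    have hi' : i ≤ n.pred := Nat.le_pred_of_lt (Finset.mem_range.mp hi)
    have hr : 0 ≤ r := (norm_nonneg x).trans hx
    have hp : ∀ k, ‖x ^ k‖ ≤ r ^ k := fun k =>
      (norm_pow_le x k).trans (pow_le_pow_left₀ (norm_nonneg x) hx k)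
    calc _ ≤ ‖x ^ (n.pred - i)‖ * ‖x ^ i‖ :=
          ContinuousLinearMap.opNorm_mulLeftRight_apply_apply_le ℝ A _ _
      _ ≤ r ^ (n.pred - i) * r ^ i := by
          gcongr
          · exact hp _
          · exact hp _
      _ = r ^ n.pred := by rw [← pow_add, Nat.sub_add_cancel hi']
  calc _ ≤ ∑ _i ∈ Finset.range n, r ^ n.pred := Finset.sum_le_sum h
    _ = n * r ^ n.pred := by simp

/-- Since `n / n! = 1 / (n-1)!`, dropping the vanishing term `n = 0` leaves the exponential series
of `r`. -/
theorem summable_expTermDeriv_bound (r : ℝ) :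
    Summable fun n : ℕ => (n ! : ℝ)⁻¹ * (n * r ^ n.pred) := by
  rw [← summable_nat_add_iff 1]
  refine (Real.summable_pow_div_factorial r).congr fun n => ?_
  have : (n ! : ℝ) ≠ 0 := by positivity
  have : (n + 1 : ℝ) ≠ 0 := by positivity
  rw [Nat.factorial_succ, Nat.pred_succ]
  push_cast
  field_simp

variable [CompleteSpace A]

theorem summable_expTermDeriv (x : A) : Summable (expTermDeriv x) :=
  .of_norm_bounded (summable_expTermDeriv_bound ‖x‖) (norm_expTermDeriv_le le_rfl)

/-- Termwise differentiation, justified by the uniform bound on the ball of radius `‖x‖ + 1`, which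
contains `x` in its interior. -/
theorem hasFDerivAt_exp_tsum (x : A) :
    HasFDerivAt (exp : A → A) (∑' n, expTermDeriv x n) x := by
  have hx : x ∈ Metric.ball (0 : A) (‖x‖ + 1) := by simp
  have h0 : Summable fun n : ℕ => (n ! : ℝ)⁻¹ • x ^ n := expSeries_summable' (𝕂 := ℝ) x
  have hd : ∀ (n : ℕ) (y : A), y ∈ Metric.ball (0 : A) (‖x‖ + 1) →
      ‖expTermDeriv y n‖ ≤ (n ! : ℝ)⁻¹ * (n * (‖x‖ + 1) ^ n.pred) :=
    fun n y hy => norm_expTermDeriv_le (mem_ball_zero_iff.mp hy).le n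
  have h := hasFDerivAt_tsum_of_isPreconnected (𝕜 := ℝ)
    (f := fun (n : ℕ) (y : A) => (n ! : ℝ)⁻¹ • y ^ n) (f' := fun n y => expTermDeriv y n)
    (summable_expTermDeriv_bound (‖x‖ + 1)) Metric.isOpen_ball
    (convex_ball (0 : A) _).isPreconnected (fun n y _ => hasFDerivAt_expTerm y n) hd hx h0 hx
  rwa [← exp_eq_tsum ℝ (𝔸 := A)] at h

/-- For a trace `τ` and `c` commuting with `x`, `τ (c · D exp_x z) = τ (c eˣ z)`. -/
theorem trace_fderiv_exp (τ : A →L[ℝ] B) (hτ : ∀ a b, τ (a * b) = τ (b * a)) {c x : A}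
    (hc : Commute c x) (z : A) :
    τ (c * (∑' n, expTermDeriv x n) z) = τ (c * exp x * z) := by
  let L : (A →L[ℝ] A) →L[ℝ] B :=
    (τ.comp (ContinuousLinearMap.mul ℝ A c)).comp (ContinuousLinearMap.apply ℝ A z)
  let M : A →L[ℝ] B :=
    τ.comp ((ContinuousLinearMap.mul ℝ A c).comp ((ContinuousLinearMap.mul ℝ A).flip z))
  have h1 : HasSum (fun n => L (expTermDeriv x n)) (τ (c * (∑' n, expTermDeriv x n) z)) :=
    (summable_expTermDeriv x).hasSum.mapL L
  have h2 : HasSum (fun n : ℕ => M ((n ! : ℝ)⁻¹ • x ^ n)) (τ (c * (exp x * z))) :=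
    (exp_series_hasSum_exp' (𝕂 := ℝ) x).mapL M
  have h3 : ∀ n, L (expTermDeriv x (n + 1)) = M ((n ! : ℝ)⁻¹ • x ^ n) := by
    intro n
    change τ (c * expTermDeriv x (n + 1) z) = τ (c * (((n ! : ℝ)⁻¹ • x ^ n) * z))
    -- Cyclicity of `τ` carries `xⁱ` to the front, past `c`, to rejoin `x^(n-i)`. All `n + 1`
    -- summands coincide, which turns `1/(n+1)!` into `1/n!`.
    have h4 : ∀ i ∈ Finset.range (n + 1),
        τ (c * (x ^ (n - i) * z * x ^ i)) = τ (c * (x ^ n * z)) := by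
      intro i hi
      have hi' : i ≤ n := Nat.le_of_lt_succ (Finset.mem_range.mp hi)
      rw [← mul_assoc, ← mul_assoc, hτ, ← mul_assoc, ← mul_assoc, ← (hc.pow_right i).eq,
        mul_assoc c, ← pow_add, Nat.add_sub_cancel' hi', mul_assoc]
    rw [expTermDeriv_apply, Nat.pred_succ, mul_smul_comm, smul_mul_assoc, mul_smul_comm,
      map_smul, map_smul, Finset.mul_sum, map_sum, Finset.sum_congr rfl h4, Finset.sum_const,
      Finset.card_range, ← Nat.cast_smul_eq_nsmul ℝ, smul_smul, Nat.factorial_succ]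
    congr 1
    have : (n ! : ℝ) ≠ 0 := by positivity
    have : (n + 1 : ℝ) ≠ 0 := by positivity
    push_cast
    field_simp
  have h0 : L (expTermDeriv x 0) = 0 := by
    change τ (c * expTermDeriv x 0 z) = 0
    simp [expTermDeriv_apply]
  have h5 := (hasSum_nat_add_iff' 1).mpr h1
  simp only [h3, Finset.sum_range_one, h0, sub_zero] at h5
  rw [mul_assoc]
  exact h5.unique h2

/-- If `x(s)` is differentiable at `s₀` and `e^{x(s)}` agrees near `s₀` with a curve of derivative
`e^{x(s₀)} y`, then `τ (x(s₀) x'(s₀)) = τ (x(s₀) y)` for every trace `τ`. -/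
theorem trace_mul_deriv_log (τ : A →L[ℝ] B) (hτ : ∀ a b, τ (a * b) = τ (b * a)) {x g : ℝ → A}
    {s₀ : ℝ} {x' y : A} (hx : HasDerivAt x x' s₀) (hg : HasDerivAt g (exp (x s₀) * y) s₀)
    (hxg : (fun s => exp (x s)) =ᶠ[𝓝 s₀] g) : τ (x s₀ * x') = τ (x s₀ * y) := by
  let _ : NormedAlgebra ℚ A := NormedAlgebra.restrictScalars ℚ ℝ A
  have h1 := (hasFDerivAt_exp_tsum (x s₀)).comp_hasDerivAt s₀ hx
  have h2 := h1.unique (hg.congr_of_eventuallyEq hxg)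
  have hinv : exp (-x s₀) * exp (x s₀) = 1 := by
    rw [← NormedSpace.exp_add_of_commute (Commute.refl _).neg_left, neg_add_cancel, exp_zero]
  -- The choice `c = x e^{-x}` cancels the factor `eˣ` on both sides and leaves `τ(x ·)`.
  have hc : Commute (x s₀ * exp (-x s₀)) (x s₀) :=
    (Commute.refl _).mul_left (Commute.exp_left (Commute.refl _).neg_left)
  have h3 := trace_fderiv_exp τ hτ hc x'
  rw [h2, mul_assoc, ← mul_assoc (exp (-x s₀)), hinv, one_mul, mul_assoc (x s₀), hinv,
    mul_one] at h3
  exact h3.symm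

end traceExp

/-! ### Lifting from `PSL` to `SL` and differentiating the logarithm -/

section gradient

open scoped Matrix.Norms.Operator

variable {Λ : ℝ}

/-- Makes the operator norm of the identity matrix equal to one, as the power estimates in the
exponential series require. -/
instance instNormOneClassRL (Λ : ℝ) : NormOneClass (RL Λ) where
  norm_one := by
    change |(1 : ℝ)| + (1 + |Λ|) * |(0 : ℝ)| = 1
    simp

/-- From `2(c-1) = -(c-1)²` follows `2‖c-1‖ ≤ ‖c-1‖²`, so `1` is isolated among the square roots of
unity. This covers rings with more such roots than `±1`, as `R_Λ` is for `Λ > 0`. -/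
theorem eq_one_of_sq_eq_one {R : Type*} [NormedCommRing R] [NormedAlgebra ℝ R] {c : R}
    (h : c ^ 2 = 1) (hc : ‖c - 1‖ < 2) : c = 1 := by
  have h1 : (2 : ℝ) • (c - 1) = -((c - 1) * (c - 1)) := by
    rw [two_smul]
    linear_combination h
  have h2 : 2 * ‖c - 1‖ ≤ ‖c - 1‖ * ‖c - 1‖ := by
    have h3 := congrArg norm h1
    rw [norm_smul, norm_neg, Real.norm_ofNat] at h3
    exact h3.trans_le (norm_mul_le _ _)
  have h4 := norm_nonneg (c - 1)
  have h5 : ‖c - 1‖ = 0 := by nlinarith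
  exact sub_eq_zero.mp (norm_eq_zero.mp h5)

theorem expSL_neg {R : Type} [NormedCommRing R] [NormedAlgebra ℝ R] [CompleteSpace R]
    (X : sl2 R) : expSL (-X) = (expSL X)⁻¹ := by
  let _ : NormedAlgebra ℚ R := NormedAlgebra.restrictScalars ℚ ℝ R
  refine eq_inv_of_mul_eq_one_left (Subtype.ext ?_)
  change NormedSpace.exp (-X.1) * NormedSpace.exp X.1 = 1
  rw [← Matrix.exp_add_of_commute _ _ (Commute.refl X.1).neg_left, neg_add_cancel,
    NormedSpace.exp_zero]

/-- The identification of `𝔥_Λ` with traceless matrices as a continuous linear map. -/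
def toMat (Λ : ℝ) : hAlg Λ →L[ℝ] Matrix (Fin 2) (Fin 2) (RL Λ) :=
  LinearMap.toContinuousLinearMap
    { toFun := fun x => (toSl x).1
      map_add' := fun x y => congrArg Subtype.val (toSl_add x y)
      map_smul' := fun t x => by
        rw [toSl_real_smul]
        exact algebraMap_smul (RL Λ) t (toSl x).1 }

/-- The trace as a continuous linear map. -/
def traceL (Λ : ℝ) : Matrix (Fin 2) (Fin 2) (RL Λ) →L[ℝ] RL Λ :=
  LinearMap.toContinuousLinearMap (Matrix.traceLinearMap (Fin 2) ℝ (RL Λ))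

/-- Equality in `PSL` leaves a central scalar `c(s)` with `c(s)² = 1`. It depends continuously on
`s` at `0`, where it equals `1`, so it is `1` nearby and the equality holds for matrices. -/
theorem exp_eventuallyEq_of_expIsom {x : ℝ → hAlg Λ} {Y : hAlg Λ} (hx : ContinuousAt x 0)
    (h : ∀ᶠ s : ℝ in 𝓝 0, expIsom (x s) = expIsom (x 0) * expIsom (s • Y)) :
    (fun s => NormedSpace.exp (toMat Λ (x s))) =ᶠ[𝓝 0]
      fun s => NormedSpace.exp (toMat Λ (x 0)) * NormedSpace.exp (s • toMat Λ Y) := by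
  let _ : NormedAlgebra ℚ (RL Λ) := NormedAlgebra.restrictScalars ℚ ℝ (RL Λ)
  let _ : NormedAlgebra ℚ (Matrix (Fin 2) (Fin 2) (RL Λ)) :=
    NormedAlgebra.restrictScalars ℚ ℝ _
  -- The discrepancy is a scalar matrix only for those `s` where `h` holds. One entry recovers the
  -- scalar and is defined for all `s`.
  let c : ℝ → RL Λ := fun s => (NormedSpace.exp (-toMat Λ (x s)) *
    (NormedSpace.exp (toMat Λ (x 0)) * NormedSpace.exp (s • toMat Λ Y))) 0 0
  have hinv : NormedSpace.exp (-toMat Λ (x 0)) *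
      (NormedSpace.exp (toMat Λ (x 0)) * NormedSpace.exp ((0 : ℝ) • toMat Λ Y)) = 1 := by
    rw [zero_smul, NormedSpace.exp_zero, mul_one]
    exact (Matrix.exp_add_of_commute _ _ (Commute.refl (toMat Λ (x 0))).neg_left).symm.trans
      (by rw [neg_add_cancel, NormedSpace.exp_zero])
  have hc0 : c 0 = 1 := congrFun (congrFun hinv 0) 0
  have hc : ContinuousAt c 0 := by
    have h1 : ContinuousAt (fun s => NormedSpace.exp (-toMat Λ (x s))) 0 :=
      NormedSpace.exp_continuous.continuousAt.comp ((toMat Λ).continuous.continuousAt.comp hx).neg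
    have h2 : Continuous fun s : ℝ => NormedSpace.exp (s • toMat Λ Y) :=
      NormedSpace.exp_continuous.comp (continuous_id.smul continuous_const)
    have h3 := h1.mul ((continuous_const (y := NormedSpace.exp (toMat Λ (x 0)))).mul
      h2).continuousAt
    exact ((continuous_apply 0).comp (continuous_apply 0)).continuousAt.comp h3
  have hnear : ∀ᶠ s in 𝓝 (0 : ℝ), ‖c s - 1‖ < 2 := by
    have h1 : ContinuousAt (fun s => ‖c s - 1‖) 0 := (hc.sub continuousAt_const).norm
    refine h1.eventually_lt continuousAt_const ?_
    simp [hc0]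
  filter_upwards [h, hnear] with s hs hn
  have hmem : (expSL (toSl (x s)))⁻¹ * (expSL (toSl (x 0)) * expSL (toSl (s • Y))) ∈
      Subgroup.center SL(2, RL Λ) := QuotientGroup.eq.mp hs
  obtain ⟨r, hr, hrM⟩ := Matrix.SpecialLinearGroup.mem_center_iff.mp hmem
  have hval : ((expSL (toSl (x s)))⁻¹ * (expSL (toSl (x 0)) * expSL (toSl (s • Y)))).1 =
      NormedSpace.exp (-toMat Λ (x s)) *
        (NormedSpace.exp (toMat Λ (x 0)) * NormedSpace.exp (s • toMat Λ Y)) := by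
    rw [← expSL_neg, ← map_smul]
    rfl
  have hrc : r = c s := by
    have h1 := congrFun (congrFun (hrM.trans hval) 0) 0
    exact h1
  have hr1 : r = 1 := eq_one_of_sq_eq_one (by simpa using hr) (by rw [hrc]; exact hn)
  have hone : (expSL (toSl (x s)))⁻¹ * (expSL (toSl (x 0)) * expSL (toSl (s • Y))) = 1 :=
    Subtype.ext (by rw [← hrM, hr1, map_one]; rfl)
  have hfin := congrArg Subtype.val (inv_mul_eq_one (G := SL(2, RL Λ)).mp hone)
  change NormedSpace.exp (toMat Λ (x s)) = _
  rw [← map_smul]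
  exact hfin

theorem expIsom_zero : expIsom (0 : hAlg Λ) = 1 := by
  have h0 : toSl (0 : hAlg Λ) = 0 := Subtype.ext (map_zero (toMat Λ))
  have h1 : expSL (0 : sl2 (RL Λ)) = 1 := Subtype.ext NormedSpace.exp_zero
  rw [expIsom, h0, expPSL, h1]
  rfl

namespace LogBranch

variable (b : LogBranch Λ)

theorem gK_deriv_log {u : Isom Λ} (hu : u ∈ b.dom) (Y : hAlg Λ) {x' : hAlg Λ}
    (hx : HasDerivAt (fun s : ℝ => b.log (u * expIsom (s • Y))) x' 0) :
    gK (RL Λ) (toSl (b.log u)) (toSl x') = gK (RL Λ) (toSl (b.log u)) (toSl Y) := by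
  set x : ℝ → hAlg Λ := fun s => b.log (u * expIsom (s • Y)) with hxdef
  have hx0 : x 0 = b.log u := by simp only [hxdef, zero_smul, expIsom_zero, mul_one]
  have hev : ∀ᶠ s : ℝ in 𝓝 0, expIsom (x s) = expIsom (x 0) * expIsom (s • Y) := by
    filter_upwards [b.dom_open u hu Y] with s hs
    rw [b.exp_log _ hs, hx0, b.exp_log u hu]
  have hxg := exp_eventuallyEq_of_expIsom hx.continuousAt hev
  have hX : HasDerivAt (fun s => toMat Λ (x s)) (toMat Λ x') 0 :=
    (toMat Λ).hasFDerivAt.comp_hasDerivAt 0 hx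
  have hg : HasDerivAt (fun s : ℝ =>
      NormedSpace.exp (toMat Λ (x 0)) * NormedSpace.exp (s • toMat Λ Y))
      (NormedSpace.exp (toMat Λ (x 0)) * toMat Λ Y) 0 := by
    have h1 := (hasDerivAt_exp_smul_const (𝕂 := ℝ) (toMat Λ Y) 0).const_mul
      (NormedSpace.exp (toMat Λ (x 0)))
    exact h1.congr_deriv (by simp)
  have h := trace_mul_deriv_log (traceL Λ) (fun M N => Matrix.trace_mul_comm M N) hX hg hxg
  rw [hx0] at h
  exact h

end LogBranch

end gradient

/-! ### The gradients, the functions `G` and the transformations `T` -/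

namespace LogBranch

variable {Λ : ℝ} (b : LogBranch Λ)

theorem kap_pairing_deriv_log {u : Isom Λ} (hu : u ∈ b.dom) (Y : hAlg Λ) {x' : hAlg Λ}
    (hx : HasDerivAt (fun s : ℝ => b.log (u * expIsom (s • Y))) x' 0) :
    kap Λ (b.log u) x' = kap Λ (b.log u) Y ∧ pairing Λ (b.log u) x' = pairing Λ (b.log u) Y := by
  have h := b.gK_deriv_log hu Y hx
  rw [gK_toSl, gK_toSl] at h
  have hre := congrArg QuadraticAlgebra.re h
  have him := congrArg QuadraticAlgebra.im h
  simp [Θ] at hre him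
  exact ⟨hre, him⟩

/-- By symmetry of `β` the two terms of the product rule agree, which absorbs the factor `1/2`. -/
theorem hasDerivAt_formFun {β : LinearMap.BilinForm ℝ (hAlg Λ)} (hβ : ∀ x y, β x y = β y x)
    {u : Isom Λ} {Y x' : hAlg Λ} (hu : b.log (u * expIsom ((0 : ℝ) • Y)) = b.log u)
    (hx : HasDerivAt (fun s : ℝ => b.log (u * expIsom (s • Y))) x' 0) :
    HasDerivAt (fun s : ℝ => b.formFun β (u * expIsom (s • Y))) (β (b.log u) x') 0 := by
  have h := (β.toContinuousBilinearMap.hasFDerivAt_of_bilinear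
    hx.hasFDerivAt hx.hasFDerivAt).hasDerivAt.const_mul (1 / 2 : ℝ)
  refine h.congr_deriv ?_
  have h1 := hβ x' (b.log u)
  rw [hu]
  simp [h1]
  ring

theorem gVec_eq {β : LinearMap.BilinForm ℝ (hAlg Λ)} {f : Isom Λ → ℝ} {u : Isom Λ}
    (h : ∀ Y, HasDerivAt (fun s : ℝ => f (u * expIsom (s • Y))) (β (b.log u) Y) 0) :
    gVec f u = lMap β (b.log u) := by
  have h1 : ((hBasis Λ).constr ℝ fun a => rDeriv f u (hBasis Λ a)) = β (b.log u) :=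
    (hBasis Λ).ext fun a => by
      rw [Module.Basis.constr_basis]
      exact (h (hBasis Λ a)).deriv
  rw [gVec, h1]
  rfl

theorem hasDerivAt_tTilde_kapTilde {u : Isom Λ} (hu : u ∈ b.dom) (Y : hAlg Λ) :
    HasDerivAt (fun s : ℝ => b.tTilde (u * expIsom (s • Y))) (pairing Λ (b.log u) Y) 0 ∧
      HasDerivAt (fun s : ℝ => b.kapTilde (u * expIsom (s • Y))) (kap Λ (b.log u) Y) 0 := by
  have hx := (b.log_diff u hu Y).hasDerivAt
  have h0 : b.log (u * expIsom ((0 : ℝ) • Y)) = b.log u := by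
    rw [zero_smul, expIsom_zero, mul_one]
  obtain ⟨h1, h2⟩ := b.kap_pairing_deriv_log hu Y hx
  rw [← h1, ← h2]
  refine ⟨b.hasDerivAt_formFun (fun x y => ?_) h0 hx, b.hasDerivAt_formFun (fun x y => ?_) h0 hx⟩
  · simp only [pairing, LinearMap.mk₂_apply, eta]
    ring
  · simp only [kap, LinearMap.mk₂_apply, eta]
    ring

theorem gVec_tTilde {u : Isom Λ} (hu : u ∈ b.dom) : gVec b.tTilde u = b.log u := by
  rw [b.gVec_eq fun Y => (b.hasDerivAt_tTilde_kapTilde hu Y).1, lMap_pairing]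
  rfl

theorem gVec_kapTilde {u : Isom Λ} (hu : u ∈ b.dom) :
    gVec b.kapTilde u = lMap (kap Λ) (b.log u) :=
  b.gVec_eq fun Y => (b.hasDerivAt_tTilde_kapTilde hu Y).2

theorem GMap_tTilde {u : Isom Λ} (hu : u ∈ b.dom) (s : RL Λ) : GMap b.tTilde s u = b.pow s u := by
  rw [GMap, b.gVec_tTilde hu, pow]

theorem GMap_kapTilde {u : Isom Λ} (hu : u ∈ b.dom) (s : RL Λ) :
    GMap b.kapTilde s u = expPSL ((s * Θ Λ) • toSl (b.log u)) := by
  rw [GMap, b.gVec_kapTilde hu, toSl_lMap_kap, smul_smul]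

theorem GMap_kapTilde_eq_GMap_tTilde {u : Isom Λ} (hu : u ∈ b.dom) (s : RL Λ) :
    GMap b.kapTilde s u = GMap b.tTilde (s * Θ Λ) u := by
  rw [b.GMap_kapTilde hu, b.GMap_tTilde hu, pow]

theorem GMap_kapTilde_eq_expIsom {u : Isom Λ} (hu : u ∈ b.dom) (t : ℝ) :
    GMap b.kapTilde (algebraMap ℝ (RL Λ) t) u =
      expIsom (hAlg.mk ((Λ * t) • (b.log u).k) (t • (b.log u).p) : hAlg Λ) := by
  rw [b.GMap_kapTilde hu, expIsom, toSl_smul]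
  congr 2
  refine hAlg.ext ?_ ?_ <;> simp [Θ]

/-- The function `f` enters `T` only through the factors `G_f` at the `H_{η_k}`, all of them in the
domain. No property of the curve or of the ordering is needed. -/
theorem T_kapTilde {g : ℕ} (η : CurveData g) (AB : (Fin g → Isom Λ) × (Fin g → Isom Λ))
    (h : ∀ k, wordHol AB.1 AB.2 (η.cyc k) ∈ b.dom) (s : RL Λ) :
    η.T b.kapTilde s AB = η.T b.tTilde (s * Θ Λ) AB := by
  have hf : ∀ y, η.factor b.kapTilde s AB y = η.factor b.tTilde (s * Θ Λ) AB y := fun y => by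
    rw [CurveData.factor, CurveData.factor]
    congr 2
    refine List.map_congr_left fun k _ => ?_
    rw [b.GMap_kapTilde_eq_GMap_tTilde (h k)]
    congr 1
    ring
  simp only [CurveData.T, hf]

theorem gKTilde_eq (u : Isom Λ) :
    b.gKTilde u = algebraMap ℝ (RL Λ) (1 / 2 * b.kapTilde u) +
      Θ Λ * algebraMap ℝ (RL Λ) (1 / 2 * b.tTilde u) := by
  rw [gKTilde, gK_toSl, kapTilde, tTilde, formFun, formFun]
  ext <;> simp [Θ]

end LogBranch

/-! ### Functoriality of `PSL(2, ·)` -/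

section projective

variable {R S : Type} [CommRing R] [CommRing S]

/-- The homomorphism of projective special linear groups induced by a ring homomorphism. -/
def mapPSL (f : R →+* S) : PSL(2, R) →* PSL(2, S) :=
  QuotientGroup.map _ _ (Matrix.SpecialLinearGroup.map f) fun u hu => by
    obtain ⟨r, hr, hru⟩ := Matrix.SpecialLinearGroup.mem_center_iff.mp hu
    refine Matrix.SpecialLinearGroup.mem_center_iff.mpr ⟨f r, by rw [← map_pow, hr, map_one], ?_⟩
    change _ = f.mapMatrix u.1
    rw [← hru]
    simp [Matrix.diagonal_map]

theorem mapPSL_mk (f : R →+* S) (u : SL(2, R)) :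
    mapPSL f (QuotientGroup.mk u) = QuotientGroup.mk (Matrix.SpecialLinearGroup.map f u) := rfl

/-- As equations between entries, centrality can be transported along ring homomorphisms in both
directions. The determinant supplies the condition that the scalar squares to one. -/
theorem mem_center_SL2_iff {u : SL(2, R)} :
    u ∈ Subgroup.center SL(2, R) ↔
      u.1 0 1 = 0 ∧ u.1 1 0 = 0 ∧ u.1 0 0 = u.1 1 1 := by
  rw [Matrix.SpecialLinearGroup.mem_center_iff]
  constructor
  · rintro ⟨r, -, h⟩
    have h' : Matrix.scalar (Fin 2) r = u.1 := h
    rw [← h']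
    simp
  · rintro ⟨h01, h10, h00⟩
    refine ⟨u.1 0 0, ?_, ?_⟩
    · have h := u.2
      rw [Matrix.det_fin_two, h01, ← h00] at h
      simpa [pow_two] using h
    · ext i j
      fin_cases i <;> fin_cases j <;> simp_all

theorem map_slJ [Algebra ℝ R] [Algebra ℝ S] (f : R →ₐ[ℝ] S) (v : Fin 3 → R) :
    (slJ v).1.map f = (slJ fun a => f (v a)).1 := by
  rw [slJ_val, slJ_val]
  ext i j
  fin_cases i <;> fin_cases j <;> simp <;> simp [Algebra.smul_def, mul_add]

end projective

theorem mapPSL_expPSL_slJ {R S : Type} [NormedCommRing R] [NormedAlgebra ℝ R] [CompleteSpace R]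
    [NormedCommRing S] [NormedAlgebra ℝ S] [CompleteSpace S] (f : R →ₐ[ℝ] S) (hf : Continuous f)
    (v : Fin 3 → R) :
    mapPSL f.toRingHom (expPSL (slJ v)) = expPSL (slJ fun a => f (v a)) := by
  let _ : NormedAlgebra ℚ R := NormedAlgebra.restrictScalars ℚ ℝ R
  let _ : NormedAlgebra ℚ S := NormedAlgebra.restrictScalars ℚ ℝ S
  rw [expPSL, mapPSL_mk, expPSL]
  congr 1
  refine Subtype.ext ?_
  change f.toRingHom.mapMatrix (NormedSpace.exp (slJ v).1) = NormedSpace.exp _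
  rw [← map_slJ]
  have hc : Continuous (f.toRingHom.mapMatrix (m := Fin 2)) := continuous_id.matrix_map hf
  open scoped Matrix.Norms.Operator in
  -- The uniform structure of the operator norm is the entrywise one.
  have : @CompleteSpace (Matrix (Fin 2) (Fin 2) R) PseudoMetricSpace.toUniformSpace :=
    inferInstanceAs (CompleteSpace (Fin 2 → Fin 2 → R))
  open scoped Matrix.Norms.Operator in
  exact NormedSpace.map_exp f.toRingHom.mapMatrix hc _

/-! ### `Λ > 0`: the product of two copies of `PSL(2, ℝ)` -/

section evaluation

variable {Λ : ℝ}

/-- The homomorphism `a + Θ b ↦ a + c b` for a square root `c` of `Λ`. -/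
def evalRL {S : Type} [CommRing S] [Algebra ℝ S] (c : S) (hc : c * c = algebraMap ℝ S Λ) :
    RL Λ →ₐ[ℝ] S :=
  QuadraticAlgebra.lift ⟨c, by simp [hc, Algebra.algebraMap_eq_smul_one]⟩

theorem evalRL_apply {S : Type} [CommRing S] [Algebra ℝ S] (c : S)
    (hc : c * c = algebraMap ℝ S Λ) (z : RL Λ) :
    evalRL c hc z = algebraMap ℝ S z.re + algebraMap ℝ S z.im * c := by
  simp [evalRL, Algebra.smul_def]

theorem continuous_evalRL {S : Type} [NormedCommRing S] [NormedAlgebra ℝ S] (c : S)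
    (hc : c * c = algebraMap ℝ S Λ) : Continuous (evalRL c hc) :=
  (evalRL c hc).toLinearMap.continuous_of_finiteDimensional

theorem evalRL_toSl_arg {S : Type} [CommRing S] [Algebra ℝ S] (c : S)
    (hc : c * c = algebraMap ℝ S Λ) (x : hAlg Λ) :
    (fun a => evalRL c hc ⟨x.p a, x.k a⟩) =
      fun a => algebraMap ℝ S (x.p a) + algebraMap ℝ S (x.k a) * c :=
  funext fun _ => evalRL_apply c hc _

theorem mapPSL_evalRL_expIsom {S : Type} [NormedCommRing S] [NormedAlgebra ℝ S] [CompleteSpace S]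
    (c : S) (hc : c * c = algebraMap ℝ S Λ) (x : hAlg Λ) :
    mapPSL (evalRL c hc).toRingHom (expIsom x) =
      expPSL (slJ fun a => algebraMap ℝ S (x.p a) + algebraMap ℝ S (x.k a) * c) := by
  rw [expIsom, toSl, mapPSL_expPSL_slJ _ (continuous_evalRL c hc), evalRL_toSl_arg]

theorem map_mem_center_SL2_iff {R S : Type} [CommRing R] [CommRing S] {f : R →+* S}
    {u : SL(2, R)} : Matrix.SpecialLinearGroup.map f u ∈ Subgroup.center SL(2, S) ↔
      f (u.1 0 1) = 0 ∧ f (u.1 1 0) = 0 ∧ f (u.1 0 0) = f (u.1 1 1) :=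
  mem_center_SL2_iff

theorem sqrt_mul_self_algebraMap (h : 0 < Λ) : √Λ * √Λ = algebraMap ℝ ℝ Λ :=
  Real.mul_self_sqrt h.le

theorem neg_sqrt_mul_self_algebraMap (h : 0 < Λ) : -√Λ * -√Λ = algebraMap ℝ ℝ Λ :=
  (neg_mul_neg _ _).trans (Real.mul_self_sqrt h.le)

/-- The homomorphism `PSL(2, R_Λ) → PSL(2, ℝ) × PSL(2, ℝ)` for `Λ > 0`. -/
def isomToProd (h : 0 < Λ) : Isom Λ →* PSL(2, ℝ) × PSL(2, ℝ) :=
  (mapPSL (evalRL (√Λ) (sqrt_mul_self_algebraMap h)).toRingHom).prod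
    (mapPSL (evalRL (-√Λ) (neg_sqrt_mul_self_algebraMap h)).toRingHom)

theorem eq_of_evalRL_eq (h : 0 < Λ) {z w : RL Λ}
    (h1 : evalRL (√Λ) (sqrt_mul_self_algebraMap h) z =
      evalRL (√Λ) (sqrt_mul_self_algebraMap h) w)
    (h2 : evalRL (-√Λ) (neg_sqrt_mul_self_algebraMap h) z =
      evalRL (-√Λ) (neg_sqrt_mul_self_algebraMap h) w) : z = w := by
  have hs := Real.sqrt_pos.mpr h
  simp only [evalRL_apply, Algebra.algebraMap_self, RingHom.id_apply] at h1 h2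
  ext
  · linarith
  · exact mul_right_cancel₀ hs.ne' (by linarith)

theorem exists_evalRL_eq (h : 0 < Λ) (a b : ℝ) : ∃ z : RL Λ,
    evalRL (√Λ) (sqrt_mul_self_algebraMap h) z = a ∧
      evalRL (-√Λ) (neg_sqrt_mul_self_algebraMap h) z = b := by
  have hs := Real.sqrt_pos.mpr h
  refine ⟨⟨(a + b) / 2, (a - b) / (2 * √Λ)⟩, ?_, ?_⟩ <;>
  · simp only [evalRL_apply, Algebra.algebraMap_self, RingHom.id_apply]
    field_simp
    ring

/-- The two evaluations identify `R_Λ` with `ℝ × ℝ`, where `c² = 1` has the four solutions `(±1,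
±1)`. Dividing by this whole centre, not only by `±1`, makes the signs of the two factors
independent. -/
theorem isomToProd_bijective (h : 0 < Λ) : Function.Bijective (isomToProd h) := by
  constructor
  · rw [injective_iff_map_eq_one]
    rintro ⟨u⟩ hu
    refine (QuotientGroup.eq_one_iff u).mpr (mem_center_SL2_iff.mpr ?_)
    have h1 := map_mem_center_SL2_iff.mp ((QuotientGroup.eq_one_iff _).mp (congrArg Prod.fst hu))
    have h2 := map_mem_center_SL2_iff.mp ((QuotientGroup.eq_one_iff _).mp (congrArg Prod.snd hu))
    exact ⟨eq_of_evalRL_eq h (h1.1.trans (map_zero _).symm) (h2.1.trans (map_zero _).symm),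
      eq_of_evalRL_eq h (h1.2.1.trans (map_zero _).symm) (h2.2.1.trans (map_zero _).symm),
      eq_of_evalRL_eq h h1.2.2 h2.2.2⟩
  · rintro ⟨⟨v⟩, ⟨w⟩⟩
    choose z hz1 hz2 using exists_evalRL_eq h
    let M : Matrix (Fin 2) (Fin 2) (RL Λ) := Matrix.of fun i j => z (v.1 i j) (w.1 i j)
    have hM1 : (evalRL (√Λ) (sqrt_mul_self_algebraMap h)).toRingHom.mapMatrix M = v.1 :=
      Matrix.ext fun i j => hz1 _ _
    have hM2 : (evalRL (-√Λ) (neg_sqrt_mul_self_algebraMap h)).toRingHom.mapMatrix M = w.1 :=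
      Matrix.ext fun i j => hz2 _ _
    have hdet : M.det = 1 := eq_of_evalRL_eq h
      ((RingHom.map_det _ M).trans ((congrArg Matrix.det hM1).trans (v.2.trans (map_one _).symm)))
      ((RingHom.map_det _ M).trans ((congrArg Matrix.det hM2).trans (w.2.trans (map_one _).symm)))
    refine ⟨QuotientGroup.mk ⟨M, hdet⟩, Prod.ext ?_ ?_⟩
    · exact congrArg QuotientGroup.mk (Subtype.ext hM1)
    · exact congrArg QuotientGroup.mk (Subtype.ext hM2)

theorem isomToProd_expIsom (h : 0 < Λ) (x : hAlg Λ) :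
    isomToProd h (expIsom x) =
      (expPSL (slJ (x.p + √Λ • x.k)), expPSL (slJ (x.p - √Λ • x.k))) := by
  refine Prod.ext ?_ ?_
  · refine (mapPSL_evalRL_expIsom _ _ x).trans ?_
    congr 2
    ext a
    simp [mul_comm]
  · refine (mapPSL_evalRL_expIsom _ _ x).trans ?_
    congr 2
    ext a
    simp [mul_comm, sub_eq_add_neg]

end evaluation

/-! ### `Λ < 0`: `R_Λ` is the field of complex numbers -/

section negative

variable {Λ : ℝ}

theorem I_mul_sqrt_mul_self (h : Λ < 0) :
    (Complex.I * (√|Λ| : ℝ)) * (Complex.I * (√|Λ| : ℝ)) = algebraMap ℝ ℂ Λ := by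
  have h1 : ((√|Λ| : ℝ) : ℂ) * (√|Λ| : ℝ) = -(Λ : ℂ) := by
    rw [← Complex.ofReal_mul, Real.mul_self_sqrt (abs_nonneg _), abs_of_neg h, Complex.ofReal_neg]
  rw [Complex.coe_algebraMap]
  linear_combination (-1 : ℂ) * h1 + ((√|Λ| : ℝ) : ℂ) * (√|Λ| : ℝ) * Complex.I_mul_I

theorem evalRL_complex_bijective (h : Λ < 0) :
    Function.Bijective (evalRL _ (I_mul_sqrt_mul_self h)) := by
  have hs : √|Λ| ≠ 0 := (Real.sqrt_pos.mpr (abs_pos.mpr h.ne)).ne'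
  constructor
  · rw [injective_iff_map_eq_zero]
    intro z hz
    rw [evalRL_apply] at hz
    have hre := congrArg Complex.re hz
    have him := congrArg Complex.im hz
    simp [hs] at hre him
    ext
    · exact hre
    · exact him
  · intro w
    refine ⟨⟨w.re, w.im / √|Λ|⟩, ?_⟩
    rw [evalRL_apply]
    apply Complex.ext <;> simp [hs]

theorem mapPSL_bijective {R S : Type} [CommRing R] [CommRing S] {f : R →+* S}
    (hf : Function.Bijective f) : Function.Bijective (mapPSL f) := by
  constructor
  · rw [injective_iff_map_eq_one]
    rintro ⟨u⟩ hu
    refine (QuotientGroup.eq_one_iff u).mpr (mem_center_SL2_iff.mpr ?_)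
    have h1 := map_mem_center_SL2_iff.mp ((QuotientGroup.eq_one_iff _).mp hu)
    exact ⟨hf.1 (h1.1.trans (map_zero _).symm), hf.1 (h1.2.1.trans (map_zero _).symm),
      hf.1 h1.2.2⟩
  · rintro ⟨v⟩
    choose z hz using hf.2
    let M : Matrix (Fin 2) (Fin 2) R := Matrix.of fun i j => z (v.1 i j)
    have hM : f.mapMatrix M = v.1 := Matrix.ext fun i j => hz _
    have hdet : M.det = 1 := hf.1
      ((RingHom.map_det _ M).trans ((congrArg Matrix.det hM).trans (v.2.trans (map_one _).symm)))
    exact ⟨QuotientGroup.mk ⟨M, hdet⟩, congrArg QuotientGroup.mk (Subtype.ext hM)⟩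

end negative

/-! ### `Λ = 0`: the exponential over a central element of square zero -/

section infinitesimal

open NormedSpace (exp)

variable {A : Type*} [NormedRing A] [NormedAlgebra ℝ A]

/-- The affine vector field `v ↦ k + [p, v]` as a linear operator on `A × ℝ`. -/
def adAffine (p k : A) : (A × ℝ) →L[ℝ] (A × ℝ) :=
  ((ContinuousLinearMap.mul ℝ A p - (ContinuousLinearMap.mul ℝ A).flip p).comp
      (ContinuousLinearMap.fst ℝ A ℝ) +
    (ContinuousLinearMap.snd ℝ A ℝ).smulRight k).prod 0

theorem adAffine_apply (p k : A) (v : A × ℝ) :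
    adAffine p k v = (p * v.1 - v.1 * p + v.2 • k, 0) := rfl

/-- The first application to `(0, 1)` produces `k` and kills the second coordinate; afterwards only
`ad_p` acts. This delay explains `(n + 1)!` next to `ad_pⁿ`. -/
theorem adAffine_pow_succ (p k : A) (n : ℕ) :
    (adAffine p k ^ (n + 1)) (0, 1) = ((fun v => p * v - v * p)^[n] k, 0) := by
  induction n with
  | zero => simp [adAffine_apply]
  | succ n ih =>
    rw [pow_succ', mul_apply_eq_comp, ih, adAffine_apply, Function.iterate_succ_apply']
    simp

/-- The solution of the linear differential equation `y' = M y` and its power series at time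
one. -/
theorem exists_linear_flow {E : Type*} [NormedAddCommGroup E] [NormedSpace ℝ E] [CompleteSpace E]
    (M : E →L[ℝ] E) (v : E) : ∃ y : ℝ → E, y 0 = v ∧ (∀ t, HasDerivAt y (M (y t)) t) ∧
    HasSum (fun n : ℕ => (n ! : ℝ)⁻¹ • (M ^ n) v) (y 1) := by
  refine ⟨fun t => exp (t • M) v, by simp, fun t => ?_, ?_⟩
  · exact (ContinuousLinearMap.apply ℝ E v).hasFDerivAt.comp_hasDerivAt t
      (hasDerivAt_exp_smul_const' (𝕂 := ℝ) M t)
  · have h : HasSum (fun n : ℕ => ContinuousLinearMap.apply ℝ E v ((n ! : ℝ)⁻¹ • M ^ n))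
        (ContinuousLinearMap.apply ℝ E v (exp M)) :=
      (NormedSpace.exp_series_hasSum_exp' (𝕂 := ℝ) M).mapL _
    simpa using h

variable [CompleteSpace A]

/-- The solution of `G' = k + [p, G]`, `G(0) = 0`, and its power series at time one. -/
theorem exists_ad_flow (p k : A) : ∃ G : ℝ → A, G 0 = 0 ∧
    (∀ t, HasDerivAt G (k + (p * G t - G t * p)) t) ∧
    HasSum (fun n : ℕ => ((n + 1)! : ℝ)⁻¹ • (fun v => p * v - v * p)^[n] k) (G 1) := by
  obtain ⟨y, hy0, hy, hsum⟩ := exists_linear_flow (adAffine p k) (0, 1)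
  have hfst : ∀ t, HasDerivAt (fun t => (y t).1) (adAffine p k (y t)).1 t := fun t =>
    (ContinuousLinearMap.fst ℝ A ℝ).hasFDerivAt.comp_hasDerivAt t (hy t)
  -- The auxiliary coordinate stays equal to `1`, so the first coordinate obeys the inhomogeneous
  -- equation.
  have hy2 : ∀ t, (y t).2 = 1 := by
    have hd : ∀ t, HasDerivAt (fun t => (y t).2) 0 t := fun t =>
      (ContinuousLinearMap.snd ℝ A ℝ).hasFDerivAt.comp_hasDerivAt t (hy t)
    intro t
    rw [is_const_of_deriv_eq_zero (fun t => (hd t).differentiableAt) (fun t => (hd t).deriv) t 0,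
      hy0]
  refine ⟨fun t => (y t).1, congrArg Prod.fst hy0, fun t => ?_, ?_⟩
  · refine (hfst t).congr_deriv ?_
    rw [adAffine_apply, hy2, one_smul, add_comm]
  · have h1 := (hasSum_nat_add_iff' 1).mpr (hsum.mapL (ContinuousLinearMap.fst ℝ A ℝ))
    simp only [map_smul, adAffine_pow_succ, Finset.sum_range_one, pow_zero,
      one_apply_eq_self, ContinuousLinearMap.coe_fst', smul_zero, sub_zero] at h1
    exact h1

/-- `exp (p + θ k) = (1 + θ G) exp p` for `θ` central of square zero. -/
theorem exp_add_central_mul {B : Type*} [NormedRing B] [NormedAlgebra ℝ B] [CompleteSpace B]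
    (ι : A →ₐ[ℝ] B) (hι : Continuous ι) {θ : B} (hθ : ∀ b, Commute θ b) (hθ2 : θ * θ = 0)
    {p k : A} {G : ℝ → A} (hG0 : G 0 = 0)
    (hG : ∀ t, HasDerivAt G (k + (p * G t - G t * p)) t) :
    exp (ι p + θ * ι k) = (1 + θ * ι (G 1)) * ι (exp p) := by
  let _ : NormedAlgebra ℚ B := NormedAlgebra.restrictScalars ℚ ℝ B
  let ιL : A →L[ℝ] B := ⟨ι.toLinearMap, hι⟩
  let X := ι p + θ * ι k
  let H : ℝ → B := fun t => exp (t • -X) * ((1 + θ * ι (G t)) * ι (exp (t • p)))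
  have hH : ∀ t, HasDerivAt H 0 t := by
    intro t
    have h1 : HasDerivAt (fun t : ℝ => ι (exp (t • p))) (ι (p * exp (t • p))) t :=
      ιL.hasFDerivAt.comp_hasDerivAt t (hasDerivAt_exp_smul_const' (𝕂 := ℝ) p t)
    have h2 : HasDerivAt (fun t : ℝ => 1 + θ * ι (G t)) (θ * ι (k + (p * G t - G t * p))) t :=
      ((ιL.hasFDerivAt.comp_hasDerivAt t (hG t)).const_mul θ).const_add 1
    have h3 := (hasDerivAt_exp_smul_const (𝕂 := ℝ) (-X) t).mul (h2.mul h1)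
    refine h3.congr_deriv ?_
    -- The order-zero terms cancel at once, the terms linear in `θ` cancel by the equation for `G`,
    -- and `θ² = 0` removes the rest.
    have h4 : -X * (1 + θ * ι (G t)) + θ * ι (k + (p * G t - G t * p)) +
        (1 + θ * ι (G t)) * ι p = 0 := by
      have e1 : ι p * (θ * ι (G t)) = θ * (ι p * ι (G t)) := by
        rw [← mul_assoc, ← (hθ (ι p)).eq, mul_assoc]
      have e2 : θ * ι k * (θ * ι (G t)) = 0 := by
        rw [(hθ (ι k)).eq, mul_assoc, ← mul_assoc θ θ, hθ2, zero_mul, mul_zero]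
      change -(ι p + θ * ι k) * _ + _ + _ = 0
      rw [neg_mul, mul_add, add_mul, add_mul, e1, e2, map_add, map_sub, map_mul, map_mul]
      noncomm_ring
    calc _ = exp (t • -X) * ((-X * (1 + θ * ι (G t)) + θ * ι (k + (p * G t - G t * p)) +
        (1 + θ * ι (G t)) * ι p) * ι (exp (t • p))) := by
          rw [map_mul ι p, Pi.mul_apply]
          simp only [add_mul, mul_add, mul_assoc, add_assoc]
      _ = 0 := by rw [h4, zero_mul, mul_zero]
  have h01 : H 1 = H 0 :=
    is_const_of_deriv_eq_zero (fun t => (hH t).differentiableAt) (fun t => (hH t).deriv) 1 0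
  have h0 : H 0 = 1 := by
    simp [H, hG0]
  have h1 : exp (-X) * ((1 + θ * ι (G 1)) * ι (exp p)) = 1 := by
    have h2 : H 1 = 1 := h01.trans h0
    simpa only [H, one_smul] using h2
  have hX : exp X * exp (-X) = 1 := by
    rw [← NormedSpace.exp_add_of_commute (Commute.refl X).neg_right, add_neg_cancel,
      NormedSpace.exp_zero]
  calc exp X = exp X * (exp (-X) * ((1 + θ * ι (G 1)) * ι (exp p))) := by rw [h1, mul_one]
    _ = _ := by rw [← mul_assoc, hX, one_mul]

end infinitesimal

/-! ### `Λ = 0`: the Poincaré group -/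

section poincare

@[simp] theorem re_one_RL {Λ : ℝ} : (1 : RL Λ).re = 1 := rfl

@[simp] theorem im_one_RL {Λ : ℝ} : (1 : RL Λ).im = 0 := rfl

theorem zero_mul_self_algebraMap : (0 : ℝ) * 0 = algebraMap ℝ ℝ 0 := by simp

/-- The homomorphism `a + Θ b ↦ a` from `R_0` to `ℝ`. -/
def reRL : RL 0 →ₐ[ℝ] ℝ := evalRL 0 zero_mul_self_algebraMap

theorem reRL_apply (z : RL 0) : reRL z = z.re := by
  simp [reRL, evalRL_apply]

/-- The real part `A` of `A + Θ B ∈ SL(2, R_0)`. -/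
def reSL : SL(2, RL 0) →* SL(2, ℝ) := Matrix.SpecialLinearGroup.map reRL.toRingHom

theorem reSL_apply (u : SL(2, RL 0)) (i j : Fin 2) : (reSL u).1 i j = (u.1 i j).re :=
  reRL_apply _

/-- The translation part `B A⁻¹` of `A + Θ B ∈ SL(2, R_0)`. -/
def transPart (u : SL(2, RL 0)) : sl2 ℝ :=
  ⟨u.1.map QuadraticAlgebra.im * (reSL u)⁻¹.1, by
    -- The `Θ`-part of `det(A + ΘB) = 1` is `Tr(B adj A) = 0`, and `adj A = A⁻¹`.
    have h := congrArg QuadraticAlgebra.im u.2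
    rw [Matrix.det_fin_two] at h
    change Matrix.trace (u.1.map QuadraticAlgebra.im * (reSL u).1.adjugate) = 0
    rw [Matrix.adjugate_fin_two, Matrix.trace_fin_two]
    simp [Matrix.mul_apply, reSL_apply] at h ⊢
    linear_combination h⟩

theorem transPart_mul_reSL (u : SL(2, RL 0)) :
    (transPart u).1 * (reSL u).1 = u.1.map QuadraticAlgebra.im := by
  change u.1.map QuadraticAlgebra.im * (reSL u)⁻¹.1 * (reSL u).1 = _
  have h : (reSL u)⁻¹.1 * (reSL u).1 = 1 := congrArg Subtype.val (inv_mul_cancel (reSL u))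
  rw [mul_assoc, h, mul_one]

theorem transPart_eq_iff {u : SL(2, RL 0)} {a : sl2 ℝ} :
    transPart u = a ↔ a.1 * (reSL u).1 = u.1.map QuadraticAlgebra.im := by
  constructor
  · rintro rfl
    exact transPart_mul_reSL u
  · intro h
    refine Subtype.ext ?_
    have h2 : (reSL u).1 * (reSL u)⁻¹.1 = 1 := congrArg Subtype.val (mul_inv_cancel (reSL u))
    change u.1.map QuadraticAlgebra.im * (reSL u)⁻¹.1 = _
    rw [← h, mul_assoc, h2, mul_one]

theorem transPart_mul (u v : SL(2, RL 0)) :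
    transPart (u * v) = transPart u + adFun (reSL u) (transPart v) := by
  rw [transPart_eq_iff]
  have h1 : (reSL (u * v)).1 = (reSL u).1 * (reSL v).1 := congrArg Subtype.val (map_mul reSL u v)
  have h2 : (reSL u)⁻¹.1 * (reSL u).1 = 1 := congrArg Subtype.val (inv_mul_cancel (reSL u))
  change ((transPart u).1 + (reSL u).1 * (transPart v).1 * (reSL u)⁻¹.1) * _ = _
  rw [h1, add_mul, ← mul_assoc, transPart_mul_reSL, mul_assoc _ (reSL u)⁻¹.1,
    ← mul_assoc (reSL u)⁻¹.1, h2, one_mul, mul_assoc, transPart_mul_reSL]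
  change _ = (u.1 * v.1).map QuadraticAlgebra.im
  ext i j
  simp [Matrix.mul_apply, reSL_apply]
  ring

/-- The homomorphism `A + Θ B ↦ (B A⁻¹, A)`. -/
def slToPoincare : SL(2, RL 0) →* Poincare where
  toFun u := ⟨Multiplicative.ofAdd (transPart u), QuotientGroup.mk (reSL u)⟩
  map_one' := by
    have h : transPart 1 = 0 := by
      rw [transPart_eq_iff]
      ext i j
      fin_cases i <;> fin_cases j <;> simp
    rw [h, map_one]
    rfl
  map_mul' u v := by
    rw [transPart_mul, map_mul]
    rfl

theorem slToPoincare_eq_one_iff {u : SL(2, RL 0)} :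
    slToPoincare u = 1 ↔ u ∈ Subgroup.center SL(2, RL 0) := by
  have h1 : slToPoincare u = 1 ↔ transPart u = 0 ∧ reSL u ∈ Subgroup.center SL(2, ℝ) := by
    rw [← QuotientGroup.eq_one_iff]
    constructor
    · intro h
      exact ⟨congrArg (fun w : Poincare => w.left.toAdd) h, congrArg (fun w : Poincare => w.right) h⟩
    · rintro ⟨ha, hA⟩
      exact SemidirectProduct.ext (congrArg Multiplicative.ofAdd ha) hA
  rw [h1, transPart_eq_iff, mem_center_SL2_iff, mem_center_SL2_iff]
  simp only [reSL_apply]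
  constructor
  · rintro ⟨hB, h01, h10, h00⟩
    have him : ∀ i j, (u.1 i j).im = 0 := fun i j => by
      have h := congrFun (congrFun hB i) j
      simpa using h.symm
    exact ⟨QuadraticAlgebra.ext h01 (him _ _), QuadraticAlgebra.ext h10 (him _ _),
      QuadraticAlgebra.ext h00 ((him _ _).trans (him _ _).symm)⟩
  · rintro ⟨h01, h10, h00⟩
    -- A central scalar `a + Θb` satisfies `a² = 1` and `2ab = 0`, hence `b = 0`: the centre has no
    -- translation part.
    have hdet := u.2
    rw [Matrix.det_fin_two, h01, ← h00] at hdet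
    have hre := congrArg QuadraticAlgebra.re hdet
    have him := congrArg QuadraticAlgebra.im hdet
    simp at hre him
    have hne : (u.1 0 0).re ≠ 0 := fun h => by simp [h] at hre
    have h0 : (u.1 0 0).im = 0 := by
      refine (mul_eq_zero.mp (?_ : (u.1 0 0).re * (u.1 0 0).im = 0)).resolve_left hne
      linarith
    refine ⟨?_, by simp [h01], by simp [h10], by rw [h00]⟩
    ext i j
    fin_cases i <;> fin_cases j
    · simp [h0]
    · simp [h01]
    · simp [h10]
    · simp [← h00, h0]

theorem slToPoincare_surjective : Function.Surjective slToPoincare := by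
  rintro ⟨a, ⟨A⟩⟩
  -- The preimage is `A + Θ aA`, of determinant `det A (1 + Θ Tr a) = 1`.
  let M : Matrix (Fin 2) (Fin 2) (RL 0) :=
    Matrix.of fun i j => ⟨A.1 i j, (a.toAdd.1 * A.1) i j⟩
  have ha : a.toAdd.1 0 0 + a.toAdd.1 1 1 = 0 := by
    rw [← Matrix.trace_fin_two]
    exact a.toAdd.2
  have hdet : M.det = 1 := by
    have hA := A.2
    rw [Matrix.det_fin_two] at hA ⊢
    ext
    · simpa [M] using hA
    · simp [M, Matrix.mul_apply]
      linear_combination (A.1 0 0 * A.1 1 1 - A.1 0 1 * A.1 1 0) * ha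
  let u : SL(2, RL 0) := ⟨M, hdet⟩
  have hre : reSL u = A := Subtype.ext (Matrix.ext fun i j => reSL_apply _ i j)
  have htr : transPart u = a.toAdd := by
    rw [transPart_eq_iff, hre]
    rfl
  exact ⟨u, SemidirectProduct.ext (congrArg Multiplicative.ofAdd htr)
    (congrArg QuotientGroup.mk hre)⟩

/-- The homomorphism from `PSL(2, R_0)` to the Poincaré group. -/
def isomToPoincare : Isom 0 →* Poincare :=
  QuotientGroup.lift _ slToPoincare fun _ hu => slToPoincare_eq_one_iff.mpr hu

theorem isomToPoincare_bijective : Function.Bijective isomToPoincare := by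
  constructor
  · rw [injective_iff_map_eq_one]
    rintro ⟨u⟩ hu
    exact (QuotientGroup.eq_one_iff u).mpr (slToPoincare_eq_one_iff.mp hu)
  · intro w
    obtain ⟨u, hu⟩ := slToPoincare_surjective w
    exact ⟨QuotientGroup.mk u, hu⟩

theorem ad_pow_val (p k : sl2 ℝ) (n : ℕ) :
    (((LieAlgebra.ad ℝ (sl2 ℝ) p) ^ n) k).1 = (fun v => p.1 * v - v * p.1)^[n] k.1 := by
  induction n with
  | zero => rfl
  | succ n ih =>
    rw [pow_succ', Function.iterate_succ_apply', ← ih]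
    rfl

theorem exp_toSl_zero (x : hAlg 0) :
    NormedSpace.exp (toSl x).1 =
      (1 + Θ 0 • (Tser (slJ x.p) (slJ x.k)).1.map (algebraMap ℝ (RL 0))) *
        (NormedSpace.exp (slJ x.p).1).map (algebraMap ℝ (RL 0)) := by
  open scoped Matrix.Norms.Operator in
  have hc : @CompleteSpace (Matrix (Fin 2) (Fin 2) ℝ) PseudoMetricSpace.toUniformSpace :=
    inferInstanceAs (CompleteSpace (Fin 2 → Fin 2 → ℝ))
  open scoped Matrix.Norms.Operator in
  have hc' : @CompleteSpace (Matrix (Fin 2) (Fin 2) (RL 0)) PseudoMetricSpace.toUniformSpace :=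
    inferInstanceAs (CompleteSpace (Fin 2 → Fin 2 → RL 0))
  open scoped Matrix.Norms.Operator in
  obtain ⟨G, hG0, hG, hsum⟩ := exists_ad_flow (slJ x.p : sl2 ℝ).1 (slJ x.k : sl2 ℝ).1
  have hT : (Tser (slJ x.p) (slJ x.k)).1 = G 1 := by
    let incl : sl2 ℝ →ₗ[ℝ] Matrix (Fin 2) (Fin 2) ℝ :=
      { toFun := Subtype.val, map_add' := fun _ _ => rfl, map_smul' := fun _ _ => rfl }
    let F : ℕ → sl2 ℝ := fun n =>
      ((n + 1)! : ℝ)⁻¹ • ((LieAlgebra.ad ℝ (sl2 ℝ) (slJ x.p)) ^ n) (slJ x.k)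
    have h1 : HasSum (incl ∘ F) (G 1) := by
      have hF : (incl ∘ F) = fun n => ((n + 1)! : ℝ)⁻¹ •
          (fun v => (slJ x.p).1 * v - v * (slJ x.p).1)^[n] (slJ x.k).1 := funext fun n => by
        rw [← ad_pow_val]
        rfl
      rw [hF]
      exact hsum
    -- `Tser` is summed inside `sl(2, ℝ)`, whereas the flow gives a sum of matrices. Once the limit
    -- is known to be traceless, the subspace topology transfers the sum.
    have htr : Matrix.trace (G 1) = 0 := by
      let τ := LinearMap.toContinuousLinearMap (Matrix.traceLinearMap (Fin 2) ℝ ℝ)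
      refine (h1.mapL τ).unique ?_
      have h0 : ∀ n, τ ((incl ∘ F) n) = 0 := fun n => (F n).2
      simp only [h0]
      exact hasSum_zero
    have h2 : HasSum F (⟨G 1, htr⟩ : sl2 ℝ) :=
      (Topology.IsInducing.hasSum_iff (g := incl) Topology.IsInducing.subtypeVal F
        ⟨G 1, htr⟩).mp h1
    exact congrArg Subtype.val h2.tsum_eq
  let ι : Matrix (Fin 2) (Fin 2) ℝ →ₐ[ℝ] Matrix (Fin 2) (Fin 2) (RL 0) :=
    (Algebra.ofId ℝ (RL 0)).mapMatrix
  have hΘ : Θ 0 * Θ 0 = 0 := by ext <;> simp [Θ]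
  open scoped Matrix.Norms.Operator in
  have h := exp_add_central_mul ι ι.toLinearMap.continuous_of_finiteDimensional
    (θ := Matrix.scalar (Fin 2) (Θ 0)) (fun b => Matrix.scalar_commute _ (Commute.all _) b)
    (by rw [← map_mul, hΘ, map_zero]) hG0 hG
  have hθ : ∀ N : Matrix (Fin 2) (Fin 2) (RL 0), Matrix.scalar (Fin 2) (Θ 0) * N = Θ 0 • N :=
    fun N => (Matrix.smul_eq_diagonal_mul N (Θ 0)).symm
  rw [hθ, hθ, ← hT] at h
  have hX : (toSl x).1 = ι (slJ x.p).1 + Θ 0 • ι (slJ x.k).1 := by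
    rw [toSl, slJ_val, slJ_val, slJ_val]
    ext i j <;> fin_cases i <;> fin_cases j <;> simp [ι, Θ, Algebra.ofId_apply]
  rw [hX]
  exact h

theorem isomToPoincare_expIsom (x : hAlg 0) :
    isomToPoincare (expIsom x) =
      ⟨Multiplicative.ofAdd (Tser (slJ x.p) (slJ x.k)), expPSL (slJ x.p)⟩ := by
  have h := exp_toSl_zero x
  set T := Tser (slJ x.p) (slJ x.k)
  have hij : ∀ i j, (expSL (toSl x)).1 i j =
      ⟨(expSL (slJ x.p)).1 i j, (T.1 * (expSL (slJ x.p)).1) i j⟩ := by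
    intro i j
    change NormedSpace.exp (toSl x).1 i j =
      ⟨NormedSpace.exp (slJ x.p).1 i j, (T.1 * NormedSpace.exp (slJ x.p).1) i j⟩
    rw [h]
    ext <;> fin_cases i <;> simp [add_mul, Matrix.mul_apply, Θ]
  have hre : reSL (expSL (toSl x)) = expSL (slJ x.p) :=
    Subtype.ext (Matrix.ext fun i j => (reSL_apply _ i j).trans (by rw [hij]))
  have htr : transPart (expSL (toSl x)) = T := by
    rw [transPart_eq_iff, hre]
    ext i j
    rw [Matrix.map_apply, hij]
  exact SemidirectProduct.ext (congrArg Multiplicative.ofAdd htr) (congrArg QuotientGroup.mk hre)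

theorem Tser_zero (k : sl2 ℝ) : Tser 0 k = k := by
  rw [Tser, tsum_eq_single 0]
  · simp
  · intro n hn
    simp [zero_pow hn]

end poincare

end Grafting

end

/-! ### Assembly of the statements -/

theorem mainTheorem6 (Λ : ℝ) :
    -- `𝔥_Λ` is the Lie algebra `sl(2, R_Λ)`, with `P_a = Θ J_a`
    (Function.Bijective (Grafting.toSl (Λ := Λ)) ∧
      (∀ x y : Grafting.hAlg Λ, Grafting.toSl (x + y) = Grafting.toSl x + Grafting.toSl y) ∧
      (∀ (t : ℝ) (x : Grafting.hAlg Λ),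
        Grafting.toSl (t • x) = algebraMap ℝ (Grafting.RL Λ) t • Grafting.toSl x) ∧
      (∀ x y : Grafting.hAlg Λ, Grafting.toSl ⁅x, y⁆ = ⁅Grafting.toSl x, Grafting.toSl y⁆) ∧
      (∀ a : Fin 3, Grafting.toSl (Grafting.hP Λ a) =
        Grafting.Θ Λ • Grafting.toSl (Grafting.hJ Λ a))) ∧
    -- `g_K = κ / 2 + Θ ⟨ , ⟩ / 2`
    (∀ x y : Grafting.hAlg Λ,
      Grafting.gK (Grafting.RL Λ) (Grafting.toSl x) (Grafting.toSl y) =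
        algebraMap ℝ (Grafting.RL Λ) (1 / 2 * Grafting.kap Λ x y) +
          Grafting.Θ Λ * algebraMap ℝ (Grafting.RL Λ) (1 / 2 * Grafting.pairing Λ x y)) ∧
    -- `l_t` is the identity and `l_κ` is multiplication by `Θ`
    (Grafting.lMap (Grafting.pairing Λ) = LinearMap.id ∧
      (∀ a : Fin 3, Grafting.lMap (Grafting.kap Λ) (Grafting.hJ Λ a) = Grafting.hP Λ a ∧
        Grafting.lMap (Grafting.kap Λ) (Grafting.hP Λ a) = Λ • Grafting.hJ Λ a) ∧
      (∀ x : Grafting.hAlg Λ, Grafting.toSl (Grafting.lMap (Grafting.kap Λ) x) =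
        Grafting.Θ Λ • Grafting.toSl x)) ∧
    -- the gauge group and its exponential map are those of the model spacetime, and in these
    -- terms `G_κ̃` has the explicit form known for each sign of `Λ`
    (Λ = 0 → ∃ Φ : Grafting.Isom Λ ≃* Grafting.Poincare,
      (∀ x : Grafting.hAlg Λ, Φ (Grafting.expIsom x) =
        ⟨Multiplicative.ofAdd (Grafting.Tser (Grafting.slJ x.p) (Grafting.slJ x.k)),
          Grafting.expPSL (Grafting.slJ x.p)⟩) ∧
      ∀ (b : Grafting.LogBranch Λ) (u : Grafting.Isom Λ) (t : ℝ), u ∈ b.dom →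
        Φ (Grafting.GMap b.kapTilde (algebraMap ℝ (Grafting.RL Λ) t) u) =
          ⟨Multiplicative.ofAdd (Grafting.slJ (t • (b.log u).p)), 1⟩) ∧
    (0 < Λ → ∃ Φ : Grafting.Isom Λ ≃*
        Matrix.ProjectiveSpecialLinearGroup (Fin 2) ℝ ×
          Matrix.ProjectiveSpecialLinearGroup (Fin 2) ℝ,
      (∀ x : Grafting.hAlg Λ, Φ (Grafting.expIsom x) =
        (Grafting.expPSL (Grafting.slJ (x.p + √Λ • x.k)),
          Grafting.expPSL (Grafting.slJ (x.p - √Λ • x.k)))) ∧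
      ∀ (b : Grafting.LogBranch Λ) (u : Grafting.Isom Λ) (t : ℝ), u ∈ b.dom →
        Φ (Grafting.GMap b.kapTilde (algebraMap ℝ (Grafting.RL Λ) t) u) =
          (Grafting.expPSL (Grafting.slJ ((t * √Λ) • ((b.log u).p + √Λ • (b.log u).k))),
            Grafting.expPSL (Grafting.slJ (-(t * √Λ) • ((b.log u).p - √Λ • (b.log u).k))))) ∧
    (Λ < 0 → ∃ Φ : Grafting.Isom Λ ≃* Matrix.ProjectiveSpecialLinearGroup (Fin 2) ℂ,
      (∀ x : Grafting.hAlg Λ, Φ (Grafting.expIsom x) =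
        Grafting.expPSL (Grafting.slJ fun a =>
          (x.p a : ℂ) + Complex.I * (√|Λ| : ℝ) * (x.k a : ℂ))) ∧
      ∀ (b : Grafting.LogBranch Λ) (u : Grafting.Isom Λ) (t : ℝ), u ∈ b.dom →
        Φ (Grafting.GMap b.kapTilde (algebraMap ℝ (Grafting.RL Λ) t) u) =
          Grafting.expPSL (Grafting.slJ fun a => Complex.I * (t : ℂ) * (√|Λ| : ℝ) *
            (((b.log u).p a : ℂ) + Complex.I * (√|Λ| : ℝ) * ((b.log u).k a : ℂ)))) ∧
    ∀ b : Grafting.LogBranch Λ,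
      (∀ u ∈ b.dom,
        -- the gradients `g_t̃`, `g_κ̃` of `t̃`, `κ̃` are `log` and `l_κ ∘ log`
        (∀ Y : Grafting.hAlg Λ,
          HasDerivAt (fun s : ℝ => b.tTilde (u * Grafting.expIsom (s • Y)))
            (Grafting.pairing Λ (Grafting.gVec b.tTilde u) Y) 0 ∧
          HasDerivAt (fun s : ℝ => b.kapTilde (u * Grafting.expIsom (s • Y)))
            (Grafting.pairing Λ (Grafting.gVec b.kapTilde u) Y) 0) ∧
        Grafting.gVec b.tTilde u = b.log u ∧
        Grafting.gVec b.kapTilde u = Grafting.lMap (Grafting.kap Λ) (b.log u) ∧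
        -- `G_t̃^s(u) = u ^ s` and `G_κ̃^t(exp x) = exp(t Θ x)`, hence `G_κ̃^t = G_t̃^{tΘ}`
        (∀ s : Grafting.RL Λ, Grafting.GMap b.tTilde s u = b.pow s u) ∧
        (∀ t : ℝ, Grafting.GMap b.kapTilde (algebraMap ℝ (Grafting.RL Λ) t) u =
          Grafting.expPSL
            ((algebraMap ℝ (Grafting.RL Λ) t * Grafting.Θ Λ) • Grafting.toSl (b.log u))) ∧
        (∀ t : ℝ, Grafting.GMap b.kapTilde (algebraMap ℝ (Grafting.RL Λ) t) u =
          Grafting.GMap b.tTilde (algebraMap ℝ (Grafting.RL Λ) t * Grafting.Θ Λ) u)) ∧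
      ∀ (g : ℕ) (η : Grafting.CurveData g)
        (AB : (Fin g → Grafting.Isom Λ) × (Fin g → Grafting.Isom Λ)),
        -- grafting with parameter `t` is the Dehn twist flow with parameter `tΘ`
        ((∀ k, Grafting.wordHol AB.1 AB.2 (η.cyc k) ∈ b.dom) → ∀ t : ℝ,
          η.T b.kapTilde (algebraMap ℝ (Grafting.RL Λ) t) AB =
            η.T b.tTilde (algebraMap ℝ (Grafting.RL Λ) t * Grafting.Θ Λ) AB) ∧
        -- `κ̃_η / 2` and `t̃_η / 2` are the components of the `R_Λ`-valued Wilson loop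
        η.wilson b.gKTilde AB =
          algebraMap ℝ (Grafting.RL Λ) (1 / 2 * η.wilson b.kapTilde AB) +
            Grafting.Θ Λ * algebraMap ℝ (Grafting.RL Λ) (1 / 2 * η.wilson b.tTilde AB) := by
  open Grafting in
  refine ⟨⟨toSl_bijective, toSl_add, toSl_real_smul, toSl_lie, toSl_hP⟩, gK_toSl,
    ⟨lMap_pairing, fun a => ⟨?_, ?_⟩, toSl_lMap_kap⟩, fun hΛ => ?_, fun hΛ => ?_, fun hΛ => ?_,
    fun b => ⟨fun u hu => ⟨fun Y => ⟨?_, ?_⟩, b.gVec_tTilde hu, b.gVec_kapTilde hu,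
      b.GMap_tTilde hu, fun t => b.GMap_kapTilde hu _,
      fun t => b.GMap_kapTilde_eq_GMap_tTilde hu _⟩,
      fun g η AB => ⟨fun h t => b.T_kapTilde η AB h _, b.gKTilde_eq _⟩⟩⟩
  · rw [lMap_kap]
    refine hAlg.ext ?_ ?_ <;> simp [hJ, hP]
  · rw [lMap_kap]
    refine hAlg.ext ?_ ?_ <;> simp [hJ, hP]
  · subst hΛ
    refine ⟨MulEquiv.ofBijective isomToPoincare isomToPoincare_bijective,
      isomToPoincare_expIsom, fun b u t hu => ?_⟩
    rw [b.GMap_kapTilde_eq_expIsom hu]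
    refine (isomToPoincare_expIsom _).trans ?_
    -- At `Λ = 0`, `tΘ(p + Θk) = Θtp` has no rotation part, and `T(0)` is the identity: a pure
    -- translation by `tp`.
    have h0 : (slJ ((0 * t) • (b.log u).k) : sl2 ℝ) = 0 := by
      rw [zero_mul, slJ_smul, zero_smul]
    have h1 : expPSL (0 : sl2 ℝ) = 1 :=
      congrArg QuotientGroup.mk (Subtype.ext NormedSpace.exp_zero : expSL (0 : sl2 ℝ) = 1)
    rw [mk_p, mk_k, h0, Tser_zero, h1]
  · refine ⟨MulEquiv.ofBijective (isomToProd hΛ) (isomToProd_bijective hΛ),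
      isomToProd_expIsom hΛ, fun b u t hu => ?_⟩
    rw [b.GMap_kapTilde_eq_expIsom hu]
    refine (isomToProd_expIsom hΛ _).trans ?_
    -- The evaluations send `tΘ` to `±t√Λ`, which gives the opposite signs in the two factors.
    have hs := Real.mul_self_sqrt hΛ.le
    refine Prod.ext (congrArg (fun v => expPSL (slJ v)) ?_)
      (congrArg (fun v => expPSL (slJ v)) ?_)
    · ext a
      simp only [mk_p, mk_k, Pi.add_apply, Pi.smul_apply, smul_eq_mul]
      linear_combination -(t * (b.log u).k a) * hs
    · ext a
      simp only [mk_p, mk_k, Pi.sub_apply, Pi.smul_apply, smul_eq_mul]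
      linear_combination -(t * (b.log u).k a) * hs
  · have hexp : ∀ x : hAlg Λ, mapPSL (evalRL _ (I_mul_sqrt_mul_self hΛ)).toRingHom (expIsom x) =
        expPSL (slJ fun a => (x.p a : ℂ) + Complex.I * (√|Λ| : ℝ) * (x.k a : ℂ)) := fun x => by
      rw [mapPSL_evalRL_expIsom]
      congr 2
      ext a
      simp only [Complex.coe_algebraMap]
      ring
    refine ⟨MulEquiv.ofBijective _ (mapPSL_bijective (evalRL_complex_bijective hΛ)), hexp,
      fun b u t hu => ?_⟩
    rw [b.GMap_kapTilde_eq_expIsom hu]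
    refine (hexp _).trans ?_
    have hs := I_mul_sqrt_mul_self hΛ
    rw [Complex.coe_algebraMap] at hs
    refine congrArg (fun v => expPSL (slJ v)) ?_
    ext a
    simp only [mk_p, mk_k, Pi.smul_apply, smul_eq_mul]
    push_cast
    linear_combination -((t : ℂ) * (b.log u).k a) * hs
  · rw [b.gVec_tTilde hu]
    exact (b.hasDerivAt_tTilde_kapTilde hu Y).1
  · rw [b.gVec_kapTilde hu, pairing_lMap]
    exact (b.hasDerivAt_tTilde_kapTilde hu Y).2
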